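/- Setting. For integers $r\ge 3$ and $n>r$ with $nr$ even, let $G_n$ be uniformly distributed on the simple $r$-regular graphs with vertex set $V_n=\{1,\dots,n\}$; let $d(x,y)$ be the graph distance and $d=\mathrm{diam}(G_n)$, and let $i_e(G_n)=\min_{\emptyset\ne A\subset V_n,\,|A|\le n/2}|\partial_eA|/|A|$ be the Cheeger constant, $\partial_e A$ being the set of edges between $A$ and $A^c$. On $\mathcal X=\{-1,+1\}^{V_n}$ consider the energy $$H(\sigma)=-\sum_{\{x,y\}\subset V_n,\ x\ne y}\mathcal J(d(x,y))\,\sigma_x\sigma_y-h\sum_{x\in V_n}\sigma_x ,$$ (each unordered pair counted once), where either $\mathcal J(i)=Jr^{1-i}$, or $\mathcal J(i)=Ji^{-\lambda}$ with $\lambda>2$. Let $(\sigma_t)_{t\in\mathbb N}$ be the discrete-time Metropolis chain at inverse temperature $\beta$: a vertex is chosen uniformly, and flipping its spin, which changes $\sigma$ into $\eta$, is accepted with probability $e^{-\beta[H(\eta)-H(\sigma)]_+}$. Let $\mathbb P_\sigma$ be its law when started at $\sigma$, and $\tau_{+1}=\inf\{t>0:\sigma_t=+1\}$ the first hitting time of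 the all-plus configuration. For configurations $\sigma,\eta$ let $\Phi(\sigma,\eta)$ be the minimum, over single-spin-flip paths from $\sigma$ to $\eta$, of the maximal energy along the path; the stability level of $\sigma$ is $V_\sigma=\min_{\eta:H(\eta)<H(\sigma)}\Phi(\sigma,\eta)-H(\sigma)$ ($=\infty$ if $\sigma$ is a global minimum of $H$). A configuration is metastable if its stability level equals the maximum of $V_\sigma$ over all $\sigma$ that are not global minima of $H$. The parameters $J,h$ (and $\lambda$) are called admissible for $G_n$ if $n>\max\{\lceil r^r\rceil,\lceil r^2J/h\rceil\}$, $h>0$ and $J\ge\max\{1,\lceil h/i_e(G_n)\rceil\}$. Put $$f(r,\lambda)=\begin{cases} r & \text{if }\mathcal J(i)=Jr^{1-i},\\ r-2&\text{if }\mathcal J(i)=Ji^{-\lambda},\ \lambda\ge d,\\ \zeta(\lambda)(r-1)^d&\text{if }\mathcal J(i)=Ji^{-\lambda},\ \lambda<d.\end{cases}$$ Theorem. Let $\kappa:\mathbb N\to\mathbb R$ satisfy $\kappa(r)=o(r)$ as $r\to\infty$ (for instance $\kappa$ constant, or $\kappa(r)=C\sqrt r$). There are functions $o_l,o_u:\mathbb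 N\to\mathbb R$, depending only on $\kappa$, with $o_l(r)=o(r)$ and $o_u(r)=o(r)$ as $r\to\infty$, such that for every $r\ge3$, with probability tending to $1$ as $n\to\infty$ (along $n$ with $nr$ even), $G_n$ is connected and the following holds simultaneously for both interactions, all $\lambda>2$, and all admissible $J,h$ with $h\le\kappa(r)J$. Put $$\Gamma_l=J\Bigl(\frac r2-o_l(r)\Bigr)n,\qquad \Gamma_u=J\bigl(r f(r,\lambda)+o_u(r)\bigr)n .$$ Then for every $\varepsilon>0$ $$\lim_{\beta\to\infty}\mathbb P_{-1}\Bigl(e^{\beta(\Gamma_l-\varepsilon)}<\tau_{+1}<e^{\beta(\Gamma_u+\varepsilon)}\Bigr)=1 ,$$ and the same holds with the initial configuration $-1$ (all spins minus) replaced by any metastable configuration $\eta$. -/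

import Mathlib

open Filter Topology Asymptotics MeasureTheory ProbabilityTheory
open scoped NNReal ENNReal

namespace RRGIsing

noncomputable section

/-! ### Random regular graphs -/

section Graph

variable {V : Type*} [Fintype V]

open Classical in
/-- The Cheeger constant `i_e(G)`: the minimum of `|∂_e A| / |A|` over the nonempty vertex sets `A`
with `|A| ≤ |V| / 2`, where `∂_e A` is the set of edges joining `A` to its complement. -/
def cheeger (G : SimpleGraph V) : ℝ :=
  ⨅ A : {A : Finset V // A.Nonempty ∧ 2 * A.card ≤ Fintype.card V},
    ((G.interedges A.1 A.1ᶜ).card : ℝ) / (A.1.card : ℝ)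

open Classical in
/-- `G` is an `r`-regular simple graph. -/
def IsReg (r : ℕ) (G : SimpleGraph V) : Prop := G.IsRegularOfDegree r

end Graph

/-- The probability that `P` holds for a graph chosen uniformly at random among all simple
`r`-regular graphs with vertex set `{1, …, n}`. -/
def regProb (r n : ℕ) (P : SimpleGraph (Fin n) → Prop) : ℝ :=
  (Nat.card {G : SimpleGraph (Fin n) // IsReg r G ∧ P G} : ℝ) /
    (Nat.card {G : SimpleGraph (Fin n) // IsReg r G} : ℝ)

/-- The event `P n` holds with high probability for the random `r`-regular graph on `n` vertices:
its probability tends to `1` as `n → ∞` along the `n` for which `n * r` is even. -/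
def WHP (r : ℕ) (P : ∀ n : ℕ, SimpleGraph (Fin n) → Prop) : Prop :=
  Tendsto (fun n : ℕ => regProb r n (P n)) (atTop ⊓ 𝓟 {n : ℕ | Even (n * r)}) (𝓝 1)

/-! ### The two interactions -/

/-- The two kinds of decay of the pair interaction. -/
inductive Decay where
  | exponential : Decay
  | polynomial (lam : ℝ) : Decay

/-- The exponent of the polynomial interaction has to be larger than `2`. -/
def Decay.Valid : Decay → Prop
  | .exponential => True
  | .polynomial lam => 2 < lam

/-- The interaction at distance `i`: `J * r ^ (1 - i)` or `J * i ^ (-lam)`. -/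
def interaction (r : ℕ) (J : ℝ) : Decay → ℕ → ℝ
  | .exponential, i => J * (r : ℝ) ^ (1 - (i : ℤ))
  | .polynomial lam, i => J * (i : ℝ) ^ (-lam)

/-- `ζ(lam) = ∑_{k ≥ 1} k ^ (-lam)` for real `lam > 1`. -/
def zetaReal (lam : ℝ) : ℝ := ∑' k : ℕ, ((k : ℝ) + 1) ^ (-lam)

open Classical in
/-- The function `f` in the upper bound on the energy barrier; `d` is the diameter of the
(connected) graph. -/
def fUpper (r d : ℕ) : Decay → ℝ
  | .exponential => (r : ℝ)
  | .polynomial lam =>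
      if (d : ℝ) ≤ lam then (r : ℝ) - 2 else zetaReal lam * ((r : ℝ) - 1) ^ d

/-- `J (r / 2 - e) n`, where `e` stands for the error term `o(r)`. -/
def gammaLower (r n : ℕ) (J e : ℝ) : ℝ := J * ((r : ℝ) / 2 - e) * n

/-- `J (r f + e) n`, where `e` stands for the error term `o(r)`. -/
def gammaUpper (r n d : ℕ) (J : ℝ) (D : Decay) (e : ℝ) : ℝ :=
  J * ((r : ℝ) * fUpper r d D + e) * n

/-- The standing conditions on the parameters for a graph `G` on `n` vertices. -/
structure ParamCond (r n : ℕ) (G : SimpleGraph (Fin n)) (J h : ℝ) (D : Decay) : Prop where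
  three_le : 3 ≤ r
  pow_lt : r ^ r < n
  ceil_lt : ⌈(r : ℝ) ^ 2 * J / h⌉ < (n : ℤ)
  h_pos : 0 < h
  one_le : 1 ≤ J
  ceil_le : ((⌈h / cheeger G⌉ : ℤ) : ℝ) ≤ J
  valid : D.Valid

/-! ### Configurations, energy, stability levels -/

/-- Spin configurations with values in `{-1, +1}`. -/
abbrev Config (V : Type*) := V → ℤˣ

/-- The value of a spin as a real number. -/
def spin (s : ℤˣ) : ℝ := ((s : ℤ) : ℝ)

/-- The configuration with all spins equal to `+1`. -/
def plusOne (V : Type*) : Config V := fun _ => 1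

/-- The configuration with all spins equal to `-1`. -/
def minusOne (V : Type*) : Config V := fun _ => -1

open Classical in
/-- The Hamiltonian `-∑ K (d(x,y)) σ_x σ_y - h ∑ σ_x`, where the first sum counts every unordered
pair of distinct vertices once (whence the factor `1 / 2` in front of the sum over ordered pairs).
Vertices in different connected components are at infinite distance and do not interact. -/
def energy {V : Type*} [Fintype V] (G : SimpleGraph V) (K : ℕ → ℝ) (h : ℝ) (σ : Config V) : ℝ :=
  -((1 / 2) * ∑ x, ∑ y,
      if x ≠ y ∧ G.Reachable x y then K (G.dist x y) * spin (σ x) * spin (σ y) else 0)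
    - h * ∑ x, spin (σ x)

/-- The configuration obtained from `σ` by flipping the spin at `x`. -/
def flipAt {V : Type*} [DecidableEq V] (σ : Config V) (x : V) : Config V :=
  Function.update σ x (-σ x)

theorem flipAt_flipAt {V : Type*} [DecidableEq V] (σ : Config V) (x : V) :
    flipAt (flipAt σ x) x = σ := by
  simp [flipAt]

theorem flipAt_ne {V : Type*} [DecidableEq V] (σ : Config V) (x : V) : flipAt σ x ≠ σ := by
  intro h
  have h1 : -σ x = σ x := by simpa [flipAt] using congrFun h x
  exact units_ne_neg_self (σ x) h1.symm

/-- The graph on the configurations whose edges are the single spin flips. Its walks are the paths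
over which communication heights are taken. -/
def flipGraph (V : Type*) [DecidableEq V] : SimpleGraph (Config V) where
  Adj σ η := ∃ x, flipAt σ x = η
  symm := ⟨by
    rintro σ η ⟨x, rfl⟩
    exact ⟨x, flipAt_flipAt σ x⟩⟩
  loopless := ⟨by
    rintro σ ⟨x, hx⟩
    exact flipAt_ne σ x hx⟩

/-- The communication height: the minimum over the paths from `σ` to `η` of the maximal energy
along the path. -/
def commHeight {V : Type*} [DecidableEq V] (H : Config V → ℝ) (σ η : Config V) : ℝ :=
  ⨅ w : (flipGraph V).Walk σ η, sSup (H '' {ζ | ζ ∈ w.support})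

/-- The stability level of `σ`: the least energy barrier between `σ` and a configuration of lower
energy; it is `⊤` if there is no such configuration. -/
def stabLevel {V : Type*} [DecidableEq V] (H : Config V → ℝ) (σ : Config V) : EReal :=
  ⨅ η : {η : Config V // H η < H σ}, ((commHeight H σ η.1 - H σ : ℝ) : EReal)

/-- The stable states: the global minima of the energy. -/
def stableStates {V : Type*} (H : Config V → ℝ) : Set (Config V) := {σ | ∀ η, H σ ≤ H η}

/-- The maximal stability level of the configurations that are not stable. -/
def maxStabLevel {V : Type*} [DecidableEq V] (H : Config V → ℝ) : EReal :=
  ⨆ σ : {σ : Config V // σ ∉ stableStates H}, stabLevel H σ.1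

/-- The metastable states: the configurations that attain the maximal stability level. -/
def metastableStates {V : Type*} [DecidableEq V] (H : Config V → ℝ) : Set (Config V) :=
  {σ | stabLevel H σ = maxStabLevel H}

/-! ### The Metropolis dynamics -/

section Dynamics

variable {V : Type*} [Fintype V] [DecidableEq V]

open Classical in
/-- The connectivity matrix: a uniformly chosen spin is flipped. -/
def connectivity (σ η : Config V) : ℝ :=
  if ∃ x, flipAt σ x = η then 1 / (Fintype.card V : ℝ) else 0

/-- The Metropolis transition probabilities at inverse temperature `β`. -/
def transition (H : Config V → ℝ) (β : ℝ≥0) (σ η : Config V) : ℝ :=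
  if σ = η then 1 - ∑ ζ, connectivity σ ζ * Real.exp (-(β : ℝ) * max (H ζ - H σ) 0)
  else connectivity σ η * Real.exp (-(β : ℝ) * max (H η - H σ) 0)

theorem connectivity_nonneg (σ η : Config V) : 0 ≤ connectivity σ η := by
  unfold connectivity
  split_ifs <;> positivity

theorem connectivity_self (σ : Config V) : connectivity σ σ = 0 :=
  if_neg (by rintro ⟨x, hx⟩; exact flipAt_ne σ x hx)

theorem sum_connectivity_le (σ : Config V) : ∑ η, connectivity σ η ≤ 1 := by
  classical
  have h1 : ∑ η, connectivity σ η
      = ((Finset.univ.image (flipAt σ)).card : ℝ) * (1 / (Fintype.card V : ℝ)) := by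
    have h2 : ∀ η, connectivity σ η
        = if η ∈ Finset.univ.image (flipAt σ) then 1 / (Fintype.card V : ℝ) else 0 := by
      intro η
      unfold connectivity
      simp
    rw [Finset.sum_congr rfl (fun η _ => h2 η), Finset.sum_ite_mem, Finset.univ_inter,
      Finset.sum_const, nsmul_eq_mul]
  rw [h1, mul_one_div]
  refine div_le_one_of_le₀ ?_ (Nat.cast_nonneg _)
  exact_mod_cast Finset.card_image_le

theorem transition_nonneg (H : Config V → ℝ) (β : ℝ≥0) (σ η : Config V) :
    0 ≤ transition H β σ η := by
  unfold transition
  split_ifs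
  · rw [sub_nonneg]
    refine le_trans (Finset.sum_le_sum fun ζ _ => ?_) (sum_connectivity_le σ)
    refine mul_le_of_le_one_right (connectivity_nonneg _ _) (Real.exp_le_one_iff.2 ?_)
    have h1 : 0 ≤ (β : ℝ) * max (H ζ - H σ) 0 := mul_nonneg β.2 (le_max_right _ _)
    linarith
  · exact mul_nonneg (connectivity_nonneg _ _) (Real.exp_nonneg _)

theorem sum_transition (H : Config V → ℝ) (β : ℝ≥0) (σ : Config V) :
    ∑ η, transition H β σ η = 1 := by
  have h1 : ∀ η, transition H β σ η
      = connectivity σ η * Real.exp (-(β : ℝ) * max (H η - H σ) 0) + if σ = η then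
        1 - ∑ ζ, connectivity σ ζ * Real.exp (-(β : ℝ) * max (H ζ - H σ) 0) else 0 := by
    intro η
    unfold transition
    by_cases h : σ = η
    · subst h
      simp [connectivity_self]
    · simp [h]
  rw [Finset.sum_congr rfl (fun η _ => h1 η), Finset.sum_add_distrib, Finset.sum_ite_eq]
  simp

/-- One step of the chain from `σ`. -/
def stepLaw (H : Config V → ℝ) (β : ℝ≥0) (σ : Config V) : PMF (Config V) :=
  PMF.ofFintype (fun η => ENNReal.ofReal (transition H β σ η)) (by
    rw [← ENNReal.ofReal_sum_of_nonneg (fun η _ => transition_nonneg H β σ η),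
      sum_transition, ENNReal.ofReal_one])

instance instMeasurableSingletonClassSpin : MeasurableSingletonClass ℤˣ :=
  ⟨fun u => ⟨{(u : ℤ)}, trivial, by ext v; simp [Units.ext_iff]⟩⟩

/-- The one step transition kernel of the chain. -/
def stepKernel (H : Config V → ℝ) (β : ℝ≥0) : Kernel (Config V) (Config V) :=
  Kernel.ofFunOfCountable fun σ => (stepLaw H β σ).toMeasure

instance instIsMarkovKernelStepKernel (H : Config V → ℝ) (β : ℝ≥0) :
    IsMarkovKernel (stepKernel H β) :=
  ⟨fun σ => by
    change IsProbabilityMeasure (stepLaw H β σ).toMeasure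
    infer_instance⟩

/-- The law on trajectories of the Metropolis chain started at `σ`. -/
def chainLaw (H : Config V → ℝ) (β : ℝ≥0) (σ : Config V) : Measure (ℕ → Config V) :=
  Kernel.trajMeasure (X := fun _ => Config V) (Measure.dirac σ) fun n =>
    (stepKernel H β).comap (fun ω : (i : Finset.Iic n) → Config V => ω ⟨n, by simp⟩)
      (measurable_pi_apply _)

end Dynamics

/-- The first hitting time `inf {t > 0 | ω t ∈ A}`. -/
def hitTime {V : Type*} (A : Set (Config V)) (ω : ℕ → Config V) : ℕ∞ :=
  ⨅ t : {t : ℕ // 0 < t ∧ ω t ∈ A}, (t.1 : ℕ∞)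

/-- The probability that the chain started at `σ` first hits `+1` strictly between the times
`exp (β a)` and `exp (β b)`. -/
def exitProb {V : Type*} [Fintype V] [DecidableEq V] (H : Config V → ℝ) (σ : Config V) (a b : ℝ)
    (β : ℝ≥0) : ℝ :=
  (chainLaw H β σ).real {ω |
    ENNReal.ofReal (Real.exp (β * a)) < (hitTime {plusOne V} ω : ℝ≥0∞) ∧
      (hitTime {plusOne V} ω : ℝ≥0∞) < ENNReal.ofReal (Real.exp (β * b))}

end

end RRGIsing

/-! The statement splits into a property of the graph, shown with high probability, and
deterministic bounds for reversible chains.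

Graph. With high probability $G_n$ is connected and $i_e(G_n)\ge r/2-16\sqrt r$. Both follow from
switchings: replacing $uv$ inside $A$ and $u'v'$ outside $A$ by $uu'$, $vv'$ adds two edges across
$A$. Double counting (`regCross_switching_le`) compares the numbers of $r$-regular graphs with $x$
and with $x+2$ crossing edges. Iterating this shows that graphs with no, or atypically few, crossing
edges are so rare that a union bound over $A$ survives (`card_disconnected_le`,
`card_small_cheeger_le`).

Lower bound. If $A$ is the set of plus spins, dropping all interactions beyond distance one gives
$H(\sigma)-H(-1)\ge 2J|\partial_eA|-2h|A|\ge 2(Ji_e-h)|A|$ for $|A|\le n/2$. Hence a path from $-1$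
to lower energy must pass through a configuration with $\lfloor n/2\rfloor$ plus spins, which bounds
the stability level of $-1$ (`le_stabLevel_minusOne`). A metastable configuration has at least that
stability level. So either start lies in a well of depth $\Gamma_l$, and reversibility makes an exit
before time $e^{\beta(\Gamma_l-\varepsilon)}$ exponentially unlikely (`chainLaw_exists_notMem_le`).

Upper bound. No optimal path is needed. The total range $R=\max H-\min H$ is at most $\Gamma_u$: an
energy difference is at most $\sum_{x,y}\mathcal J(d(x,y))+2hn$, with the sum over ordered pairs,
and spheres of radius $i$ have at most $r(r-1)^{i-1}$ points (`energy_range_le`). A Dirichlet form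
estimate bounds the expected time to reach $+1$ by a constant times $e^{\beta R}$ from any start
(`occupation_le`), and Markov's inequality finishes.

The errors are $o_l=16\sqrt r+|\kappa|+1$ and $o_u=2|\kappa|+4$. -/

namespace RRGIsing

/-! ### Edge switchings and their inverses. -/

section Switching

open Classical SimpleGraph

variable {V : Type*}

/-- The graph obtained by replacing the edges `uv`, `u'v'` by `uu'`, `vv'`. -/
def switching (G : SimpleGraph V) (u v u' v' : V) : SimpleGraph V :=
  ((G \ edge u v) \ edge u' v') ⊔ edge u u' ⊔ edge v v'

theorem switching_adj (G : SimpleGraph V) (u v u' v' x y : V) :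
    (switching G u v u' v').Adj x y ↔
      (G.Adj x y ∧ s(x, y) ≠ s(u, v) ∧ s(x, y) ≠ s(u', v')) ∨
        (s(x, y) = s(u, u') ∧ x ≠ y) ∨ (s(x, y) = s(v, v') ∧ x ≠ y) := by
  simp only [switching, sup_adj, sdiff_adj, edge_adj, Sym2.eq_iff, ne_eq]
  by_cases hxy : x = y
  · subst hxy
    simp
  · simp only [hxy, not_false_eq_true, and_true, or_assoc, and_assoc]

/-- Switching back along the two new edges restores the old ones. This makes the switching map
injective once the new edges are remembered. -/
theorem switching_switching (G : SimpleGraph V) {u v u' v' : V} (huv : G.Adj u v)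
    (huv' : G.Adj u' v') (h1 : u ≠ u') (h2 : v ≠ v') (h3 : u ≠ v') (h4 : v ≠ u')
    (h5 : ¬G.Adj u u') (h6 : ¬G.Adj v v') :
    switching (switching G u v u' v') u u' v v' = G := by
  ext x y
  have h5' := fun h => h5 (G.adj_symm h)
  have h6' := fun h => h6 (G.adj_symm h)
  have huv1 := G.adj_symm huv
  have huv1' := G.adj_symm huv'
  have := G.ne_of_adj (a := x) (b := y)
  have := huv.ne
  have := huv'.ne
  simp only [switching_adj, Sym2.eq_iff, ne_eq]
  grind

end Switching

/-! ### Counting regular graphs by the number of edges across a vertex set. -/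

section Counting

open Classical SimpleGraph

variable {V : Type*} [Fintype V]

/-- The number of edges between `A` and its complement. -/
noncomputable def crossing (G : SimpleGraph V) (A : Finset V) : ℕ := (G.interedges A Aᶜ).card

theorem isReg_switching {r : ℕ} {G : SimpleGraph V} (hG : IsReg r G) {u v u' v' : V}
    (huv : G.Adj u v) (huv' : G.Adj u' v') (h1 : u ≠ u') (h2 : v ≠ v') (h3 : u ≠ v')
    (h4 : v ≠ u') (h5 : ¬G.Adj u u') (h6 : ¬G.Adj v v') : IsReg r (switching G u v u' v') := by
  intro x
  rw [← hG x]
  have key : ∀ p q : V, G.Adj x p → ¬G.Adj x q →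
      (∀ y, (switching G u v u' v').Adj x y ↔ (G.Adj x y ∧ y ≠ p) ∨ y = q) →
      (switching G u v u' v').degree x = G.degree x := by
    intro p q hp hq hy
    rw [← card_neighborFinset_eq_degree, ← card_neighborFinset_eq_degree]
    have : (switching G u v u' v').neighborFinset x =
        insert q ((G.neighborFinset x).erase p) := by
      ext y
      simp only [mem_neighborFinset, hy, Finset.mem_insert, Finset.mem_erase]
      tauto
    rw [this, Finset.card_insert_of_notMem (by simp [hq]), Finset.card_erase_add_one (by simpa)]
  have h5' := fun h => h5 (G.adj_symm h)
  have h6' := fun h => h6 (G.adj_symm h)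
  have huv1 := G.adj_symm huv
  have huv1' := G.adj_symm huv'
  have n1 := huv.ne
  have n2 := huv'.ne
  by_cases hu : x = u
  · subst hu
    exact key v u' huv h5 fun y => by rw [switching_adj]; simp only [Sym2.eq_iff]; grind
  by_cases hv : x = v
  · subst hv
    exact key u v' huv1 h6 fun y => by rw [switching_adj]; simp only [Sym2.eq_iff]; grind
  by_cases hu' : x = u'
  · subst hu'
    exact key v' u huv' h5' fun y => by rw [switching_adj]; simp only [Sym2.eq_iff]; grind
  by_cases hv' : x = v'
  · subst hv'
    exact key u' v huv1' h6' fun y => by rw [switching_adj]; simp only [Sym2.eq_iff]; grind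
  rw [← card_neighborFinset_eq_degree, ← card_neighborFinset_eq_degree]
  congr 1
  ext y
  simp only [mem_neighborFinset, switching_adj, Sym2.eq_iff]
  grind

theorem crossing_switching {G : SimpleGraph V} {A : Finset V} {u v u' v' : V}
    (hu : u ∈ A) (hv : v ∈ A) (hu' : u' ∉ A) (hv' : v' ∉ A) (huv : u ≠ v)
    (h5 : ¬G.Adj u u') (h6 : ¬G.Adj v v') :
    crossing (switching G u v u' v') A = crossing G A + 2 := by
  unfold crossing
  have : (switching G u v u' v').interedges A Aᶜ =
      insert (u, u') (insert (v, v') (G.interedges A Aᶜ)) := by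
    ext ⟨x, y⟩
    simp only [mk_mem_interedges_iff, switching_adj, Sym2.eq_iff, Finset.mem_insert,
      Prod.mk.injEq, Finset.mem_compl]
    grind
  rw [this, Finset.card_insert_of_notMem, Finset.card_insert_of_notMem]
  · simp [mk_mem_interedges_iff, h6]
  · simp [mk_mem_interedges_iff, h5, huv]

theorem card_interedges_univ {r : ℕ} {G : SimpleGraph V} (hG : IsReg r G) (A : Finset V) :
    (G.interedges A Finset.univ).card = r * A.card := by
  have : G.interedges A Finset.univ =
      (A.sigma fun x => G.neighborFinset x).map (Equiv.sigmaEquivProd V V).toEmbedding := by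
    ext ⟨x, y⟩
    simp [mk_mem_interedges_iff]
  rw [this, Finset.card_map, Finset.card_sigma]
  rw [Finset.sum_congr rfl (fun x _ => by rw [card_neighborFinset_eq_degree, hG x])]
  simp [mul_comm]

theorem card_interedges_self {r : ℕ} {G : SimpleGraph V} (hG : IsReg r G) (A : Finset V) :
    (G.interedges A A).card + crossing G A = r * A.card := by
  rw [← card_interedges_univ hG A, crossing, ← Finset.union_compl A, ← Finset.card_union_of_disjoint]
  · congr 1
    ext ⟨x, y⟩
    simp only [Finset.mem_union, mk_mem_interedges_iff, Finset.mem_compl]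
    tauto
  · exact interedges_disjoint_right G A disjoint_compl_right

theorem card_interedges_compl {r : ℕ} {G : SimpleGraph V} (hG : IsReg r G) (A : Finset V) :
    (G.interedges Aᶜ Aᶜ).card + crossing G A = r * (Fintype.card V - A.card) := by
  rw [← Finset.card_compl, ← card_interedges_self hG Aᶜ]
  congr 1
  unfold crossing
  rw [compl_compl]
  have := G.symm
  exact Rel.card_interedges_comm _ _

/-- The regular graphs with `x` edges between `A` and its complement. -/
noncomputable def regCross (r : ℕ) (A : Finset V) (x : ℕ) : Finset (SimpleGraph V) :=
  {G | IsReg r G ∧ crossing G A = x}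

/-- The switchings of `G` along `A`. -/
noncomputable def switchings (G : SimpleGraph V) (A : Finset V) : Finset ((V × V) × (V × V)) :=
  {p ∈ G.interedges A A ×ˢ G.interedges Aᶜ Aᶜ | ¬G.Adj p.1.1 p.2.1 ∧ ¬G.Adj p.1.2 p.2.2}

theorem le_card_switchings {r : ℕ} {G : SimpleGraph V} (hG : IsReg r G) (A : Finset V) :
    (r * A.card - crossing G A) * (r * (Fintype.card V - A.card) - crossing G A - 2 * r ^ 2) ≤
      (switchings G A).card := by
  have h1 : r * A.card - crossing G A = (G.interedges A A).card := by
    have := card_interedges_self hG A; omega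
  have h2 : r * (Fintype.card V - A.card) - crossing G A = (G.interedges Aᶜ Aᶜ).card := by
    have := card_interedges_compl hG A; omega
  rw [h1, h2]
  -- For fixed $(u,v)$, a pair $(u',v')$ is spoiled if $u'$ is a neighbour of $u$ or $v'$ one of
  -- $v$. Each condition excludes at most $r\cdot r$ oriented edges.
  have hfib : ∀ u v : V, (G.interedges Aᶜ Aᶜ).card - 2 * r ^ 2 ≤
      ({q ∈ G.interedges Aᶜ Aᶜ | ¬G.Adj u q.1 ∧ ¬G.Adj v q.2}).card := by
    intro u v
    have hb1 : ({q ∈ G.interedges Aᶜ Aᶜ | G.Adj u q.1}).card ≤ r ^ 2 := by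
      have hs : {q ∈ G.interedges Aᶜ Aᶜ | G.Adj u q.1} ⊆
          G.interedges (G.neighborFinset u) Finset.univ := by
        rintro ⟨a, b⟩ h
        simp only [Finset.mem_filter, mk_mem_interedges_iff, mem_neighborFinset,
          Finset.mem_univ, true_and] at h ⊢
        exact ⟨h.2, h.1.2.2⟩
      refine (Finset.card_le_card hs).trans ?_
      rw [card_interedges_univ hG, card_neighborFinset_eq_degree, hG u, sq]
    have hb2 : ({q ∈ G.interedges Aᶜ Aᶜ | G.Adj v q.2}).card ≤ r ^ 2 := by
      have hs : ({q ∈ G.interedges Aᶜ Aᶜ | G.Adj v q.2}).map (Equiv.prodComm V V).toEmbedding ⊆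
          G.interedges (G.neighborFinset v) Finset.univ := by
        rintro ⟨a, b⟩ h
        simp only [Finset.mem_map, Finset.mem_filter, Prod.exists, mk_mem_interedges_iff] at h
        obtain ⟨c, d, ⟨⟨_, _, h1⟩, h2⟩, h3⟩ := h
        simp at h3
        obtain ⟨rfl, rfl⟩ := h3
        simp [mk_mem_interedges_iff, h2, h1.symm]
      have := Finset.card_le_card hs
      rw [Finset.card_map, card_interedges_univ hG, card_neighborFinset_eq_degree, hG v, ← sq] at this
      exact this
    have hu : G.interedges Aᶜ Aᶜ ⊆ {q ∈ G.interedges Aᶜ Aᶜ | ¬G.Adj u q.1 ∧ ¬G.Adj v q.2} ∪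
        ({q ∈ G.interedges Aᶜ Aᶜ | G.Adj u q.1} ∪ {q ∈ G.interedges Aᶜ Aᶜ | G.Adj v q.2}) := by
      intro q hq
      simp only [Finset.mem_union, Finset.mem_filter]
      tauto
    have h3 := (Finset.card_le_card hu).trans (Finset.card_union_le _ _)
    have h4 := Finset.card_union_le {q ∈ G.interedges Aᶜ Aᶜ | G.Adj u q.1}
      {q ∈ G.interedges Aᶜ Aᶜ | G.Adj v q.2}
    omega
  have hc : (switchings G A).card = ∑ p ∈ G.interedges A A,
      ({q ∈ G.interedges Aᶜ Aᶜ | ¬G.Adj p.1 q.1 ∧ ¬G.Adj p.2 q.2}).card := by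
    rw [switchings, Finset.card_filter, Finset.sum_product]
    simp only [Finset.card_filter]
  rw [hc, ← smul_eq_mul]
  exact Finset.card_nsmul_le_sum _ _ _ fun p _ => hfib p.1 p.2

/-- The switching inequality. -/
theorem regCross_switching_le (r : ℕ) (A : Finset V) (x : ℕ) :
    (regCross r A x).card *
        ((r * A.card - x) * (r * (Fintype.card V - A.card) - x - 2 * r ^ 2)) ≤
      (regCross r A (x + 2)).card * ((x + 2) * (x + 1)) := by
  have hl : (regCross r A x).card *
        ((r * A.card - x) * (r * (Fintype.card V - A.card) - x - 2 * r ^ 2)) ≤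
      ((regCross r A x).sigma fun G => switchings G A).card := by
    rw [Finset.card_sigma, ← smul_eq_mul]
    refine Finset.card_nsmul_le_sum _ _ _ fun G hG => ?_
    simp only [regCross, Finset.mem_filter, Finset.mem_univ, true_and] at hG
    have := le_card_switchings hG.1 A
    rwa [hG.2] at this
  -- The target: a graph with $x+2$ crossing edges and an ordered pair of distinct ones, which will
  -- be the two edges created by the switching.
  have hr : ((regCross r A (x + 2)).sigma fun G => (G.interedges A Aᶜ).offDiag).card =
      (regCross r A (x + 2)).card * ((x + 2) * (x + 1)) := by
    rw [Finset.card_sigma, Finset.sum_const_nat]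
    intro G hG
    simp only [regCross, Finset.mem_filter, Finset.mem_univ, true_and] at hG
    rw [Finset.offDiag_card]
    change crossing G A * crossing G A - crossing G A = _
    rw [hG.2, ← Nat.mul_sub_one]
    rfl
  refine hl.trans (le_trans ?_ hr.le)
  have hmem : ∀ p ∈ (regCross r A x).sigma fun G => switchings G A,
      IsReg r p.1 ∧ crossing p.1 A = x ∧ p.1.Adj p.2.1.1 p.2.1.2 ∧ p.1.Adj p.2.2.1 p.2.2.2 ∧
      p.2.1.1 ∈ A ∧ p.2.1.2 ∈ A ∧ p.2.2.1 ∉ A ∧ p.2.2.2 ∉ A ∧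
      ¬p.1.Adj p.2.1.1 p.2.2.1 ∧ ¬p.1.Adj p.2.1.2 p.2.2.2 := by
    rintro ⟨G, ⟨⟨u, v⟩, ⟨u', v'⟩⟩⟩ hp
    simp only [Finset.mem_sigma, regCross, Finset.mem_filter, Finset.mem_univ, true_and,
      switchings, Finset.mem_product, mk_mem_interedges_iff, Finset.mem_compl] at hp
    simp only
    tauto
  refine Finset.card_le_card_of_injOn
    (fun p => ⟨switching p.1 p.2.1.1 p.2.1.2 p.2.2.1 p.2.2.2,
      ((p.2.1.1, p.2.2.1), (p.2.1.2, p.2.2.2))⟩) ?_ ?_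
  · intro p hp
    obtain ⟨h1, h2, h3, h4, h5, h6, h7, h8, h9, h10⟩ := hmem p hp
    have n1 : p.2.1.1 ≠ p.2.2.1 := fun h => h7 (h ▸ h5)
    have n2 : p.2.1.2 ≠ p.2.2.2 := fun h => h8 (h ▸ h6)
    have n3 : p.2.1.1 ≠ p.2.2.2 := fun h => h8 (h ▸ h5)
    have n4 : p.2.1.2 ≠ p.2.2.1 := fun h => h7 (h ▸ h6)
    have n5 := h3.ne
    simp only [Finset.coe_sigma, Set.mem_sigma_iff, Finset.mem_coe, regCross, Finset.mem_filter,
      Finset.mem_univ, true_and, Finset.mem_offDiag, mk_mem_interedges_iff, Finset.mem_compl,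
      switching_adj]
    refine ⟨⟨isReg_switching h1 h3 h4 n1 n2 n3 n4 h9 h10, ?_⟩, ?_⟩
    · rw [crossing_switching h5 h6 h7 h8 n5 h9 h10, h2]
    · simp [h5, h6, h7, h8, n1, n2, n5]
  · rintro ⟨G, ⟨⟨u, v⟩, ⟨u', v'⟩⟩⟩ hp ⟨G', ⟨⟨w, z⟩, ⟨w', z'⟩⟩⟩ hp' heq
    have hm := hmem _ hp
    have hm' := hmem _ hp'
    simp only at hm hm'
    simp only [Sigma.mk.injEq, heq_eq_eq, Prod.mk.injEq] at heq
    obtain ⟨hG, ⟨rfl, rfl⟩, rfl, rfl⟩ := heq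
    obtain ⟨h1, h2, h3, h4, h5, h6, h7, h8, h9, h10⟩ := hm
    obtain ⟨h1', h2', h3', h4', _, _, _, _, h9', h10'⟩ := hm'
    have n1 : u ≠ u' := fun h => h7 (h ▸ h5)
    have n2 : v ≠ v' := fun h => h8 (h ▸ h6)
    have n3 : u ≠ v' := fun h => h8 (h ▸ h5)
    have n4 : v ≠ u' := fun h => h7 (h ▸ h6)
    have e1 := switching_switching G h3 h4 n1 n2 n3 n4 h9 h10
    have e2 := switching_switching G' h3' h4' n1 n2 n3 n4 h9' h10'
    rw [hG, e2] at e1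
    rw [e1]

end Counting

/-! ### Binomial inequalities. -/

section Binomials

theorem choose_mul_choose_le (m n i j : ℕ) : m.choose i * n.choose j ≤ (m + n).choose (i + j) := by
  rw [Nat.add_choose_eq]
  exact Finset.single_le_sum (f := fun ij : ℕ × ℕ => m.choose ij.1 * n.choose ij.2)
    (fun _ _ => Nat.zero_le _) (Finset.mem_coe.1 (by simp) : (i, j) ∈ Finset.HasAntidiagonal.antidiagonal (i + j))

theorem sum_choose_mul_choose (p q : ℕ) :
    ∑ j ∈ Finset.range (p + 1), p.choose j * q.choose j = (p + q).choose p := by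
  rw [Nat.add_choose_eq, ← Finset.Nat.sum_antidiagonal_swap,
    Finset.Nat.sum_antidiagonal_eq_sum_range_succ_mk]
  refine Finset.sum_congr rfl fun j hj => ?_
  simp only [Prod.swap]
  rw [Nat.choose_symm (Finset.mem_range_succ_iff.1 hj)]

/-- Pascal's rule expands each even product on the right into four; the two diagonal ones are the
terms $j=2m-1$ and $j=2m$ on the left. This removes the parity restriction, so that Vandermonde
applies. -/
theorem sum_range_le_sum_even (p q M : ℕ) :
    ∑ j ∈ Finset.range (2 * M + 1), p.choose j * q.choose j ≤
      ∑ m ∈ Finset.range (M + 1), (p + 1).choose (2 * m) * (q + 1).choose (2 * m) := by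
  induction M with
  | zero => simp
  | succ M ih =>
    rw [show 2 * (M + 1) + 1 = 2 * M + 1 + 1 + 1 by ring, Finset.sum_range_succ,
      Finset.sum_range_succ, Finset.sum_range_succ _ (M + 1), add_assoc]
    refine add_le_add ih ?_
    rw [show 2 * (M + 1) = 2 * M + 1 + 1 by ring, Nat.choose_succ_succ p, Nat.choose_succ_succ q]
    nlinarith [Nat.zero_le (p.choose (2 * M + 1) * q.choose (2 * M + 1 + 1)),
      Nat.zero_le (p.choose (2 * M + 1 + 1) * q.choose (2 * M + 1))]

/-- Each increment of the top multiplies the binomial by $N/(N-a)$ with $N$ the new top, and this is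
at most $4$ because $a\le 3N/4$. -/
theorem choose_add_le_four_pow (M k a : ℕ) (h : 4 * a ≤ 3 * M) :
    (M + k).choose a ≤ 4 ^ k * M.choose a := by
  induction k with
  | zero => simp
  | succ k ih =>
    have h1 := Nat.choose_mul_succ_eq (M + k) a
    have h2 : M + k + 1 ≤ 4 * (M + k + 1 - a) := by omega
    have h3 : (M + k + 1).choose a ≤ 4 * (M + k).choose a := by
      refine Nat.le_of_mul_le_mul_right ?_ (Nat.succ_pos (M + k))
      calc _ ≤ (M + k + 1).choose a * (4 * (M + k + 1 - a)) := Nat.mul_le_mul_left _ h2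
        _ = 4 * ((M + k).choose a * (M + k + 1)) := by rw [h1]; ring
        _ = _ := by rw [Nat.succ_eq_add_one]; ring
    calc (M + (k + 1)).choose a ≤ 4 * (M + k).choose a := h3
      _ ≤ 4 * (4 ^ k * M.choose a) := Nat.mul_le_mul_left _ ih
      _ = _ := by ring

theorem choose_add_sub_le (m a : ℕ) (j : ℕ) : m.choose a ≤ (m + j).choose (a + j) := by
  simpa using choose_mul_choose_le m j a j

/-- The product takes every second factor of the falling factorial, each being at least the one
skipped after it. -/
theorem sq_prod_le (m c : ℕ) :
    c.descFactorial (2 * m) ≤ (∏ j ∈ Finset.range m, (c - 2 * j)) ^ 2 := by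
  induction m with
  | zero => simp
  | succ m ih =>
    rw [Finset.prod_range_succ, mul_pow, show 2 * (m + 1) = 2 * m + 1 + 1 by ring,
      Nat.descFactorial_succ, Nat.descFactorial_succ]
    calc (c - (2 * m + 1)) * ((c - 2 * m) * c.descFactorial (2 * m))
        = c.descFactorial (2 * m) * ((c - 2 * m) * (c - (2 * m + 1))) := by ring
      _ ≤ _ := by
        refine Nat.mul_le_mul ih ?_
        rw [sq]
        exact Nat.mul_le_mul le_rfl (by omega)

end Binomials

/-! ### Regular graphs with no edge leaving a vertex set. -/

section Disconnected

open Classical SimpleGraph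

variable {V : Type*} [Fintype V]

/-- The regular graphs on `V`. -/
noncomputable def regGraphs (V : Type*) [Fintype V] (r : ℕ) : Finset (SimpleGraph V) := {G | IsReg r G}

theorem regCross_card_le (r : ℕ) (A : Finset V) (x : ℕ) :
    (regCross r A x).card ≤ (regGraphs V r).card :=
  Finset.card_le_card fun G hG => by
    simp only [regCross, regGraphs, Finset.mem_filter, Finset.mem_univ, true_and] at hG ⊢
    exact hG.1

/-- Iterates the switching inequality from zero crossing edges, with the degree lowered to $3$ in
the factors. Reserving $r^2$ vertices outside $A$ absorbs the loss $2r^2$. -/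
theorem regCross_zero_mul_prod_le {r : ℕ} (hr : 3 ≤ r) (A : Finset V) {b : ℕ}
    (hb : A.card + b + r ^ 2 ≤ Fintype.card V) (m : ℕ) :
    (regCross r A 0).card *
        ((∏ j ∈ Finset.range m, (3 * A.card - 2 * j)) *
          ∏ j ∈ Finset.range m, (3 * b - 2 * j)) ≤
      (regCross r A (2 * m)).card * (2 * m).factorial := by
  induction m with
  | zero => simp
  | succ m ih =>
    have h1 : 3 * A.card - 2 * m ≤ r * A.card - 2 * m :=
      Nat.sub_le_sub_right (Nat.mul_le_mul_right _ hr) _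
    have h2 : 3 * b - 2 * m ≤ r * (Fintype.card V - A.card) - 2 * m - 2 * r ^ 2 := by
      have h3 : r * (b + r ^ 2) ≤ r * (Fintype.card V - A.card) :=
        Nat.mul_le_mul_left _ (by omega)
      have h4 : 3 * b ≤ r * b := Nat.mul_le_mul_right _ hr
      have h5 : 3 * r ^ 2 ≤ r * r ^ 2 := Nat.mul_le_mul_right _ hr
      rw [mul_add] at h3
      omega
    have h6 := regCross_switching_le r A (2 * m)
    rw [Finset.prod_range_succ, Finset.prod_range_succ, show 2 * (m + 1) = 2 * m + 1 + 1 by ring,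
      Nat.factorial_succ, Nat.factorial_succ]
    calc _ = (regCross r A 0).card *
        ((∏ j ∈ Finset.range m, (3 * A.card - 2 * j)) *
          ∏ j ∈ Finset.range m, (3 * b - 2 * j)) * ((3 * A.card - 2 * m) * (3 * b - 2 * m)) := by
          ring
      _ ≤ (regCross r A (2 * m)).card * (2 * m).factorial * ((r * A.card - 2 * m) *
          (r * (Fintype.card V - A.card) - 2 * m - 2 * r ^ 2)) :=
          Nat.mul_le_mul ih (Nat.mul_le_mul h1 h2)
      _ = (regCross r A (2 * m)).card * ((r * A.card - 2 * m) *
          (r * (Fintype.card V - A.card) - 2 * m - 2 * r ^ 2)) * (2 * m).factorial := by ring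
      _ ≤ _ := Nat.mul_le_mul_right _ h6
      _ = _ := by ring

theorem regCross_zero_sq_mul_le {r : ℕ} (hr : 3 ≤ r) (A : Finset V) {b : ℕ}
    (hb : A.card + b + r ^ 2 ≤ Fintype.card V) (m : ℕ) :
    (regCross r A 0).card ^ 2 * ((3 * A.card).choose (2 * m) * (3 * b).choose (2 * m)) ≤
      (regGraphs V r).card ^ 2 := by
  have h1 := (regCross_zero_mul_prod_le hr A hb m).trans
    (Nat.mul_le_mul_right _ (regCross_card_le r A (2 * m)))
  have h2 := Nat.pow_le_pow_left h1 2
  have h3 := sq_prod_le m (3 * A.card)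
  have h4 := sq_prod_le m (3 * b)
  rw [Nat.descFactorial_eq_factorial_mul_choose] at h3 h4
  have hf : 0 < (2 * m).factorial ^ 2 := by positivity
  refine Nat.le_of_mul_le_mul_right ?_ hf
  calc _ = (regCross r A 0).card ^ 2 * (((2 * m).factorial * (3 * A.card).choose (2 * m)) *
        ((2 * m).factorial * (3 * b).choose (2 * m))) := by ring
    _ ≤ _ := Nat.mul_le_mul_left _ (Nat.mul_le_mul h3 h4)
    _ = _ := by rw [mul_pow, mul_pow]
    _ ≤ _ := h2
    _ = _ := by ring

/-- Summing the previous bound over $m\le p=3|A|-1$ costs a factor $3|A|$ and turns the products of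
binomials into one by Vandermonde. -/
theorem regCross_zero_sq_mul_choose_le {r : ℕ} (hr : 3 ≤ r) (A : Finset V) {b : ℕ}
    (hb : A.card + b + r ^ 2 ≤ Fintype.card V) (hA : 1 ≤ A.card) (hb1 : 1 ≤ b) :
    (regCross r A 0).card ^ 2 * ((3 * A.card - 1) + (3 * b - 1)).choose (3 * A.card - 1) ≤
      3 * A.card * (regGraphs V r).card ^ 2 := by
  set p := 3 * A.card - 1
  set q := 3 * b - 1
  have hp : p + 1 = 3 * A.card := by omega
  have hq : q + 1 = 3 * b := by omega
  rw [← sum_choose_mul_choose, ← hp]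
  calc _ ≤ (regCross r A 0).card ^ 2 *
        ∑ j ∈ Finset.range (2 * p + 1), p.choose j * q.choose j :=
        Nat.mul_le_mul_left _ (Finset.sum_le_sum_of_subset (by
          intro x; simp only [Finset.mem_range]; omega))
    _ ≤ _ := Nat.mul_le_mul_left _ (sum_range_le_sum_even p q p)
    _ = ∑ m ∈ Finset.range (p + 1), (regCross r A 0).card ^ 2 *
        ((p + 1).choose (2 * m) * (q + 1).choose (2 * m)) := by rw [Finset.mul_sum]
    _ ≤ ∑ m ∈ Finset.range (p + 1), (regGraphs V r).card ^ 2 :=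
        Finset.sum_le_sum fun m _ => by
          rw [hp, hq]; exact regCross_zero_sq_mul_le hr A hb m
    _ = _ := by simp

/-- The single large binomial dominates $\binom{a+b}{a}\binom{a+b-1}{a}\binom{a+b-1}{a-1}$, which
equals $\binom{a+b}{a}^3\,ab/(a+b)^2$. A cube against the square of the count leaves one spare
binomial after the union bound. -/
theorem regCross_zero_sq_mul_cube_le {r : ℕ} (hr : 3 ≤ r) (A : Finset V) {b : ℕ}
    (hb : A.card + b + r ^ 2 ≤ Fintype.card V) (hA : 1 ≤ A.card) (hb1 : A.card ≤ 3 * b) :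
    (regCross r A 0).card ^ 2 * (A.card + b).choose A.card ^ 3 ≤
      12 * (A.card + b) * (regGraphs V r).card ^ 2 := by
  have h1 := regCross_zero_sq_mul_choose_le hr A hb hA (by omega)
  set a := A.card
  obtain ⟨a', ha'⟩ : ∃ a', a = a' + 1 := ⟨a - 1, by omega⟩
  have h2 : (a + b).choose a * ((a' + b).choose a * (a' + b).choose a') ≤
      ((3 * a - 1) + (3 * b - 1)).choose (3 * a - 1) := by
    have := (Nat.mul_le_mul_left ((a + b).choose a)
      (choose_mul_choose_le (a' + b) (a' + b) a a')).trans (choose_mul_choose_le _ _ _ _)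
    rwa [show a + b + (a' + b + (a' + b)) = (3 * a - 1) + (3 * b - 1) by omega,
      show a + (a + a') = 3 * a - 1 by omega] at this
  have h3 : (a + b) * (a' + b).choose a' = a * (a + b).choose a := by
    have := Nat.add_one_mul_choose_eq (a' + b) a'
    rw [ha', show a' + 1 + b = a' + b + 1 by ring]
    linarith
  have h4 : (a + b) * (a' + b).choose a = b * (a + b).choose a := by
    have h5 := Nat.choose_succ_succ (a' + b) a'
    rw [show (a' + b).succ = a + b by omega, show a'.succ = a by omega] at h5
    have h6 : (a + b) * (a + b).choose a = a * (a + b).choose a + b * (a + b).choose a := by ring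
    nlinarith
  have hpos : 0 < a * (a + b) ^ 1 := by positivity
  refine Nat.le_of_mul_le_mul_left ?_ hpos
  have hX : (regCross r A 0).card ^ 2 * ((a + b).choose a * (((a + b) * (a' + b).choose a) *
      ((a + b) * (a' + b).choose a'))) ≤ 3 * a * (regGraphs V r).card ^ 2 * (a + b) ^ 2 := by
    calc _ = (regCross r A 0).card ^ 2 * ((a + b).choose a * ((a' + b).choose a *
          (a' + b).choose a')) * (a + b) ^ 2 := by ring
      _ ≤ _ := Nat.mul_le_mul_right _ ((Nat.mul_le_mul_left _ h2).trans h1)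
  rw [h3, h4] at hX
  calc _ = (regCross r A 0).card ^ 2 * (a + b).choose a ^ 3 * a * (a + b) := by ring
    _ ≤ (regCross r A 0).card ^ 2 * (a + b).choose a ^ 3 * a * (4 * b) :=
        Nat.mul_le_mul_left _ (by omega)
    _ = 4 * ((regCross r A 0).card ^ 2 * ((a + b).choose a * ((b * (a + b).choose a) *
      (a * (a + b).choose a)))) := by ring
    _ ≤ _ := Nat.mul_le_mul_left _ hX
    _ = _ := by ring

/-- The sets of one size contribute a fraction $O(n^{-3/2})$, so that the sum over all sizes is
$O(n^{-1/2})$. -/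
theorem choose_mul_regCross_zero_le {r : ℕ} (hr : 3 ≤ r) (A : Finset V) (hA : 4 ≤ A.card)
    (hA2 : 2 * A.card ≤ Fintype.card V) (hn : 4 * r ^ 2 ≤ Fintype.card V) :
    ((Fintype.card V).choose A.card * (regCross r A 0).card) ^ 2 * Fintype.card V ^ 3 ≤
      (16 ^ (r ^ 2) * (12 * 24 * 256)) * (regGraphs V r).card ^ 2 := by
  set n := Fintype.card V
  set a := A.card
  obtain ⟨b, hb⟩ : ∃ b, n = a + b + r ^ 2 := ⟨n - a - r ^ 2, by omega⟩
  have h1 := regCross_zero_sq_mul_cube_le hr A (b := b) hb.symm.le (by omega) (by omega)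
  change _ * (a + b).choose a ^ 3 ≤ 12 * (a + b) * _ at h1
  have h2 : n.choose a ≤ 4 ^ (r ^ 2) * (a + b).choose a := by
    rw [hb]; exact choose_add_le_four_pow _ _ _ (by omega)
  -- Here $a\ge4$ enters: the spare binomial is at least $\binom{b+4}{4}$, of order $n^4$.
  have h3 : (b + 1) ^ 4 ≤ 24 * (a + b).choose a := by
    have h4 := choose_add_sub_le (b + 4) 4 (a - 4)
    rw [show b + 4 + (a - 4) = a + b by omega, show 4 + (a - 4) = a by omega] at h4
    have h5 : (b + 4 + 1 - 4) ^ 4 ≤ Nat.factorial 4 * (b + 4).choose 4 := by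
      have h6 := Nat.pow_le_choose (α := ℚ) 4 (b + 4)
      rw [div_le_iff₀ (by positivity)] at h6
      rw [mul_comm]
      exact_mod_cast h6
    rw [show b + 4 + 1 - 4 = b + 1 by omega, show Nat.factorial 4 = 24 by rfl] at h5
    exact h5.trans (Nat.mul_le_mul_left _ h4)
  have h4 : n ^ 4 ≤ 256 * (b + 1) ^ 4 := by
    calc n ^ 4 ≤ (4 * (b + 1)) ^ 4 := Nat.pow_le_pow_left (by omega) 4
      _ = _ := by ring
  set N := (regGraphs V r).card
  set Z := (regCross r A 0).card
  set C := (a + b).choose a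
  have hC : 0 < C := Nat.choose_pos (by omega)
  have hn0 : 0 < n := by omega
  refine Nat.le_of_mul_le_mul_right ?_ (Nat.mul_pos hC hn0)
  calc (n.choose a * Z) ^ 2 * n ^ 3 * (C * n) ≤ ((4 ^ (r ^ 2) * C) * Z) ^ 2 * n ^ 3 * (C * n) := by
        gcongr
    _ = 16 ^ (r ^ 2) * n ^ 4 * (Z ^ 2 * C ^ 3) := by
        rw [show (16 : ℕ) ^ (r ^ 2) = (4 ^ (r ^ 2)) ^ 2 by rw [← pow_mul, mul_comm, pow_mul]; rfl]
        ring
    _ ≤ 16 ^ (r ^ 2) * (256 * (24 * C)) * (12 * n * N ^ 2) := by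
        refine Nat.mul_le_mul (Nat.mul_le_mul_left _ (h4.trans (Nat.mul_le_mul_left _ h3))) ?_
        exact h1.trans (Nat.mul_le_mul_right _ (Nat.mul_le_mul_left _ (by omega)))
    _ = _ := by ring

end Disconnected

/-! ### The Cheeger constant and connectedness of random regular graphs. -/

section Isoperimetry

open Classical SimpleGraph

variable {V : Type*} [Fintype V]

/-- In this range the factors of the switching inequality are at least $ra/2$ and $rn/4$, while
$(y+1)(y+2)\le(ra/2)^2(1-u)$ with $u=16/\sqrt r$, and $1-u\le e^{-u}$. -/
theorem regCross_le_mul_succ {r : ℕ} (hr : 1 ≤ r) (A : Finset V) (hA : 1 ≤ A.card)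
    (hA2 : 2 * A.card ≤ Fintype.card V) (hn : 8 * r ^ 2 ≤ Fintype.card V) (y : ℕ)
    (hy : (y : ℝ) + 2 ≤ ((r : ℝ) / 2 - 8 * √r) * A.card) :
    ((regCross r A y).card : ℝ) ≤ (regCross r A (y + 2)).card *
      (2 * A.card / Fintype.card V * Real.exp (-(16 / √r))) := by
  have hsw : ((regCross r A y).card : ℝ) * (((r * A.card - y : ℕ) : ℝ) *
      ((r * (Fintype.card V - A.card) - y - 2 * r ^ 2 : ℕ) : ℝ)) ≤
      (regCross r A (y + 2)).card * (((y : ℝ) + 2) * (y + 1)) := by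
    exact_mod_cast regCross_switching_le r A y
  set n := Fintype.card V
  set a := A.card
  have hr' : (1 : ℝ) ≤ r := by exact_mod_cast hr
  have ha' : (1 : ℝ) ≤ a := by exact_mod_cast hA
  have hA2' : 2 * (a : ℝ) ≤ n := by exact_mod_cast hA2
  have hn' : 8 * (r : ℝ) ^ 2 ≤ n := by exact_mod_cast hn
  have hs1 : 1 ≤ √(r : ℝ) := Real.one_le_sqrt.2 hr'
  have hss : √(r : ℝ) * √(r : ℝ) = r := Real.mul_self_sqrt (by linarith)
  have hy0 : (0 : ℝ) ≤ y := Nat.cast_nonneg y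
  have e1 : (r : ℝ) * a / 2 ≤ ((r * a - y : ℕ) : ℝ) := by
    have : (r : ℝ) * a - y ≤ ((r * a - y : ℕ) : ℝ) := by
      have := Nat.sub_le_iff_le_add.1 (le_refl (r * a - y))
      have h : ((r * a : ℕ) : ℝ) ≤ ((r * a - y + y : ℕ) : ℝ) := by exact_mod_cast this
      push_cast at h
      linarith
    nlinarith
  have e2 : (r : ℝ) * n / 4 ≤ ((r * (n - a) - y - 2 * r ^ 2 : ℕ) : ℝ) := by
    have h1 : (r : ℝ) * (n - a) - y - 2 * r ^ 2 ≤ ((r * (n - a) - y - 2 * r ^ 2 : ℕ) : ℝ) := by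
      have h0 : r * (n - a) ≤ (r * (n - a) - y - 2 * r ^ 2) + y + 2 * r ^ 2 := by omega
      have h : ((r * (n - a) : ℕ) : ℝ) ≤
          (((r * (n - a) - y - 2 * r ^ 2) + y + 2 * r ^ 2 : ℕ) : ℝ) := by exact_mod_cast h0
      rw [Nat.cast_mul, Nat.cast_sub (by omega)] at h
      push_cast at h ⊢
      linarith
    refine le_trans ?_ h1
    -- For small $a$ there is room in $r(n-a)$. For large $a$ the slack $8\sqrt r\,a\ge 2n$ in the
    -- hypothesis on $y$ pays for $2r^2$.
    by_cases h4 : 4 * (a : ℝ) ≤ n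
    · have h5 : (r : ℝ) * (4 * a) ≤ r * n := by gcongr
      have h6 : (r : ℝ) * r * 8 ≤ r * n := by
        nlinarith
      nlinarith [mul_nonneg (by linarith : (0 : ℝ) ≤ √r) (by linarith : (0 : ℝ) ≤ (a : ℝ))]
    · have h5 : (r : ℝ) * (2 * a) ≤ r * n := by gcongr
      have h6 : (a : ℝ) ≤ √r * a := by nlinarith
      nlinarith
  set u := 16 / √(r : ℝ) with hu
  have hur : u * r = 16 * √r := by
    rw [hu, div_mul_eq_mul_div, div_eq_iff (by positivity)]
    rw [mul_assoc, hss]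
  have hy2 : (y : ℝ) + 2 ≤ r * a / 2 * (1 - u) := by
    calc (y : ℝ) + 2 ≤ ((r : ℝ) / 2 - 8 * √r) * a := hy
      _ = (r / 2 - u * r / 2) * a := by rw [hur]; ring
      _ = _ := by ring
  have hexp : 1 - u ≤ Real.exp (-u) := by
    have := Real.add_one_le_exp (-u); linarith
  have hra : (0 : ℝ) < r * a / 2 := by positivity
  have hrn : (0 : ℝ) < r * n / 4 := by
    have : (0 : ℝ) < n := by linarith
    positivity
  have hbound : ((y : ℝ) + 2) * (y + 1) ≤ (r * a / 2) * (r * a / 2 * Real.exp (-u)) := by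
    have hu0 : 0 ≤ u := by positivity
    refine mul_le_mul ?_ ?_ (by linarith) hra.le
    · nlinarith
    · nlinarith
  have hmain : ((regCross r A y).card : ℝ) * ((r * a / 2) * (r * n / 4)) ≤
      (regCross r A (y + 2)).card * ((r * a / 2) * (r * a / 2 * Real.exp (-u))) := by
    calc _ ≤ ((regCross r A y).card : ℝ) * (((r * a - y : ℕ) : ℝ) *
        ((r * (n - a) - y - 2 * r ^ 2 : ℕ) : ℝ)) := by gcongr
      _ ≤ _ := hsw
      _ ≤ _ := by gcongr
  have hn0 : (0 : ℝ) < n := by linarith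
  refine le_of_mul_le_mul_right (hmain.trans (le_of_eq ?_)) (mul_pos hra hrn)
  field_simp
  ring

theorem regCross_le_mul_pow {r : ℕ} (hr : 1 ≤ r) (A : Finset V) (hA : 1 ≤ A.card)
    (hA2 : 2 * A.card ≤ Fintype.card V) (hn : 8 * r ^ 2 ≤ Fintype.card V) (x k : ℕ)
    (hx : (x : ℝ) + 2 * k ≤ ((r : ℝ) / 2 - 8 * √r) * A.card) :
    ((regCross r A x).card : ℝ) ≤ (regCross r A (x + 2 * k)).card *
      (2 * A.card / Fintype.card V * Real.exp (-(16 / √r))) ^ k := by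
  induction k with
  | zero => simp
  | succ k ih =>
    push_cast at hx
    refine (ih (by linarith)).trans ?_
    have h := regCross_le_mul_succ hr A hA hA2 hn (x + 2 * k) (by push_cast; linarith)
    rw [pow_succ', ← mul_assoc, show x + 2 * (k + 1) = x + 2 * k + 2 by ring]
    gcongr

theorem regCross_le_of_small {r : ℕ} (hr : 1 ≤ r) (A : Finset V) (hA : 1 ≤ A.card)
    (hA2 : 2 * A.card ≤ Fintype.card V) (hn : 8 * r ^ 2 ≤ Fintype.card V) (x : ℕ)
    (hx : (x : ℝ) ≤ ((r : ℝ) / 2 - 16 * √r) * A.card) :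
    ((regCross r A x).card : ℝ) ≤ (regGraphs V r).card *
      ((2 * A.card / Fintype.card V) ^ (2 * A.card) * Real.exp (-48 * A.card)) := by
  set n := Fintype.card V
  set a := A.card
  have hr' : (1 : ℝ) ≤ r := by exact_mod_cast hr
  have ha' : (1 : ℝ) ≤ a := by exact_mod_cast hA
  have hA2' : 2 * (a : ℝ) ≤ n := by exact_mod_cast hA2
  have hs1 : 1 ≤ √(r : ℝ) := Real.one_le_sqrt.2 hr'
  have hss : √(r : ℝ) * √(r : ℝ) = r := Real.mul_self_sqrt (by linarith)
  have hsa : 1 ≤ √(r : ℝ) * a := by nlinarith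
  -- The gap between $16\sqrt r\,a$ and $8\sqrt r\,a$ allows this many steps. As $k\ge3\sqrt r\,a$
  -- they accumulate $e^{-48a}$, and as $k\ge2a$ they give $(2a/n)^{2a}$.
  set k := ⌊4 * √(r : ℝ) * a⌋₊
  have hk1 : (k : ℝ) ≤ 4 * √r * a := Nat.floor_le (by positivity)
  have hk2 : 3 * √(r : ℝ) * a ≤ k := by
    have := Nat.lt_floor_add_one (4 * √(r : ℝ) * a)
    linarith
  have hk3 : 2 * a ≤ k := by
    have : (2 : ℝ) * a ≤ k := by nlinarith
    exact_mod_cast this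
  refine (regCross_le_mul_pow hr A hA hA2 hn x k (by linarith)).trans ?_
  have hN : ((regCross r A (x + 2 * k)).card : ℝ) ≤ (regGraphs V r).card := by
    exact_mod_cast regCross_card_le r A _
  refine mul_le_mul hN ?_ (by positivity) (by positivity)
  rw [mul_pow, ← Real.exp_nat_mul]
  have hq : 2 * (a : ℝ) / n ≤ 1 := div_le_one_of_le₀ hA2' (by positivity)
  refine mul_le_mul (pow_le_pow_of_le_one (by positivity) hq hk3) ?_ (by positivity) (by positivity)
  rw [Real.exp_le_exp]
  have h1 : 48 * (a : ℝ) = 3 * √r * a * (16 / √r) := by field_simp; norm_num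
  have h2 : 3 * √r * a * (16 / √r) ≤ k * (16 / √(r : ℝ)) := by gcongr
  linarith

theorem choose_mul_pow_le (n a : ℕ) (hn : 0 < n) :
    (n.choose a : ℝ) * ((a : ℝ) / n) ^ a ≤ Real.exp a := by
  have h1 : (n.choose a : ℝ) ≤ (n : ℝ) ^ a / a.factorial := Nat.choose_le_pow_div a n
  have h2 := Real.pow_div_factorial_le_exp (a : ℝ) (Nat.cast_nonneg a) a
  have hn' : (0 : ℝ) < n := by exact_mod_cast hn
  refine le_trans ?_ h2
  calc _ ≤ (n : ℝ) ^ a / a.factorial * ((a : ℝ) / n) ^ a := by gcongr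
    _ = _ := by rw [div_pow]; field_simp

/-- The regular graphs with few edges between `A` and its complement. -/
noncomputable def badCross (r : ℕ) (A : Finset V) : Finset (SimpleGraph V) :=
  {G | IsReg r G ∧ (crossing G A : ℝ) < ((r : ℝ) / 2 - 16 * √r) * A.card}

/-- One factor $(2a/n)^a$ cancels the number of sets, up to $(2e)^a$. The other leaves $2a/n$, which
gives the decay in $n$; $e^{-48a}$ beats everything exponential in $a$. -/
theorem choose_mul_badCross_le {r : ℕ} (hr : 1 ≤ r) (A : Finset V) (hA : 1 ≤ A.card)
    (hA2 : 2 * A.card ≤ Fintype.card V) (hn : 8 * r ^ 2 ≤ Fintype.card V) :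
    ((Fintype.card V).choose A.card : ℝ) * (badCross r A).card ≤
      (4 * r / Fintype.card V * (1 / 2) ^ A.card) * (regGraphs V r).card := by
  have hsub : badCross r A ⊆ ((Finset.range (r * A.card + 1)).filter
      (fun x : ℕ => (x : ℝ) ≤ ((r : ℝ) / 2 - 16 * √r) * A.card)).biUnion (regCross r A) := by
    intro G hG
    simp only [badCross, Finset.mem_filter, Finset.mem_univ, true_and] at hG
    simp only [Finset.mem_biUnion, Finset.mem_filter, Finset.mem_range, regCross, Finset.mem_univ,
      true_and]
    refine ⟨crossing G A, ⟨?_, hG.2.le⟩, hG.1, rfl⟩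
    have := card_interedges_self hG.1 A
    omega
  set n := Fintype.card V
  set a := A.card
  have hr' : (1 : ℝ) ≤ r := by exact_mod_cast hr
  have ha' : (1 : ℝ) ≤ a := by exact_mod_cast hA
  have hA2' : 2 * (a : ℝ) ≤ n := by exact_mod_cast hA2
  have hn0 : (0 : ℝ) < n := by linarith
  have hcard : ((badCross r A).card : ℝ) ≤ (r * a + 1) * ((regGraphs V r).card *
      ((2 * a / n) ^ (2 * a) * Real.exp (-48 * a))) := by
    set I := (Finset.range (r * a + 1)).filter
      (fun x : ℕ => (x : ℝ) ≤ ((r : ℝ) / 2 - 16 * √r) * a)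
    calc ((badCross r A).card : ℝ) ≤ ∑ x ∈ I, ((regCross r A x).card : ℝ) := by
          exact_mod_cast (Finset.card_le_card hsub).trans Finset.card_biUnion_le
      _ ≤ ∑ x ∈ I, (((regGraphs V r).card : ℝ) *
            ((2 * (a : ℝ) / n) ^ (2 * a) * Real.exp (-48 * a))) :=
          Finset.sum_le_sum fun x hx =>
            regCross_le_of_small hr A hA hA2 hn x (Finset.mem_filter.1 hx).2
      _ ≤ _ := by
          rw [Finset.sum_const, nsmul_eq_mul]
          gcongr
          exact_mod_cast (Finset.card_filter_le _ _).trans (by simp)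
  have hch := choose_mul_pow_le n a (by exact_mod_cast hn0)
  have hq : 2 * (a : ℝ) / n ≤ 1 := div_le_one_of_le₀ hA2' (by positivity)
  have hq2 : (2 * (a : ℝ) / n) ^ a ≤ 2 * a / n := by
    simpa using pow_le_pow_of_le_one (by positivity) hq hA
  have hexp : Real.exp (-48 * a) * Real.exp a ≤ (1 / 16) ^ a := by
    rw [← Real.exp_add, show -48 * (a : ℝ) + a = a * (-47) by ring, Real.exp_nat_mul]
    refine pow_le_pow_left₀ (Real.exp_pos _).le ?_ _
    rw [Real.exp_neg, ← one_div]
    refine one_div_le_one_div_of_le (by norm_num) ?_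
    have := Real.add_one_le_exp (47 : ℝ)
    linarith
  have ha2 : (a : ℝ) ^ 2 ≤ 4 ^ a := by
    have : (a : ℝ) ≤ 2 ^ a := by exact_mod_cast Nat.lt_two_pow_self.le
    calc (a : ℝ) ^ 2 ≤ (2 ^ a) ^ 2 := by gcongr
      _ = 4 ^ a := by rw [← pow_mul, mul_comm, pow_mul]; norm_num
  set N := ((regGraphs V r).card : ℝ)
  have hN : 0 ≤ N := Nat.cast_nonneg _
  calc (n.choose a : ℝ) * (badCross r A).card
      ≤ n.choose a * ((r * a + 1) * (N * ((2 * a / n) ^ (2 * a) * Real.exp (-48 * a)))) := by gcongr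
    _ = (n.choose a * ((a : ℝ) / n) ^ a) * (r * a + 1) * N * 2 ^ a * (2 * a / n) ^ a *
        Real.exp (-48 * a) := by
        rw [two_mul a, pow_add, show 2 * (a : ℝ) / n = 2 * (a / n) by ring, mul_pow]; ring
    _ ≤ Real.exp a * (2 * r * a) * N * 2 ^ a * (2 * a / n) * Real.exp (-48 * a) := by
        gcongr
        nlinarith
    _ = (4 * r / n) * (a : ℝ) ^ 2 * 2 ^ a * (Real.exp (-48 * a) * Real.exp a) * N := by ring
    _ ≤ (4 * r / n) * 4 ^ a * 2 ^ a * (1 / 16) ^ a * N := by gcongr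
    _ = (4 * r / n) * (4 * 2 * (1 / 16)) ^ a * N := by rw [mul_pow, mul_pow]; ring
    _ = _ := by norm_num

theorem four_le_card_of_crossing_eq_zero {r : ℕ} (hr : 3 ≤ r) {G : SimpleGraph V}
    (hG : IsReg r G) {A : Finset V} (hA : A.Nonempty) (h : crossing G A = 0) : 4 ≤ A.card := by
  obtain ⟨x, hx⟩ := hA
  have hsub : insert x (G.neighborFinset x) ⊆ A := by
    intro y hy
    rcases Finset.mem_insert.1 hy with rfl | hy
    · exact hx
    · by_contra hyA
      rw [crossing, Finset.card_eq_zero] at h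
      have : (x, y) ∈ G.interedges A Aᶜ := by
        rw [mk_mem_interedges_iff]
        exact ⟨hx, by simpa using hyA, by simpa using hy⟩
      simp [h] at this
  have h1 := Finset.card_le_card hsub
  rw [Finset.card_insert_of_notMem (by simp), card_neighborFinset_eq_degree, hG x] at h1
  omega

theorem exists_crossing_eq_zero [Nonempty V] {G : SimpleGraph V} (hG : ¬G.Connected) :
    ∃ A : Finset V, A.Nonempty ∧ 2 * A.card ≤ Fintype.card V ∧ crossing G A = 0 := by
  have h1 : ¬G.Preconnected := fun h => hG ⟨h⟩
  simp only [Preconnected, not_forall] at h1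
  obtain ⟨u, v, huv⟩ := h1
  set A : Finset V := {w | G.Reachable u w} with hA
  have hc : ∀ x y, x ∈ A → y ∉ A → ¬G.Adj x y := by
    intro x y hx hy hxy
    simp only [hA, Finset.mem_filter, Finset.mem_univ, true_and] at hx hy
    exact hy (hx.trans hxy.reachable)
  have hu : u ∈ A := by simp [hA]
  have hv : v ∈ Aᶜ := by simpa [hA] using huv
  have hcard := Finset.card_add_card_compl A
  by_cases h2 : 2 * A.card ≤ Fintype.card V
  · refine ⟨A, ⟨u, hu⟩, h2, Finset.card_eq_zero.2 (Finset.eq_empty_of_forall_notMem ?_)⟩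
    rintro ⟨x, y⟩ h
    rw [mk_mem_interedges_iff] at h
    exact hc x y h.1 (by simpa using h.2.1) h.2.2
  · refine ⟨Aᶜ, ⟨v, hv⟩, by omega, Finset.card_eq_zero.2 (Finset.eq_empty_of_forall_notMem ?_)⟩
    rintro ⟨x, y⟩ h
    rw [mk_mem_interedges_iff] at h
    exact hc y x (by simpa using h.2.1) (by simpa using h.1) h.2.2.symm

theorem exists_crossing_lt {G : SimpleGraph V} {c : ℝ} (hV : 2 ≤ Fintype.card V)
    (h : cheeger G < c) :
    ∃ A : Finset V, A.Nonempty ∧ 2 * A.card ≤ Fintype.card V ∧ (crossing G A : ℝ) < c * A.card := by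
  have : Nonempty V := Fintype.card_pos_iff.1 (by omega)
  obtain ⟨v⟩ := this
  have : Nonempty {A : Finset V // A.Nonempty ∧ 2 * A.card ≤ Fintype.card V} :=
    ⟨⟨{v}, by simp, by simpa⟩⟩
  obtain ⟨⟨A, hA, hA2⟩, hlt⟩ := exists_lt_of_ciInf_lt h
  refine ⟨A, hA, hA2, ?_⟩
  rwa [div_lt_iff₀ (by exact_mod_cast hA.card_pos)] at hlt

/-- Union bound over vertex sets grouped by size: the binomial on the left of `hB` is the number of
sets of that size. -/
theorem card_le_of_forall_mem_cover (S : Finset (SimpleGraph V))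
    (B : Finset V → Finset (SimpleGraph V)) (hS : ∀ G ∈ S, ∃ A, G ∈ B A) (δ : ℕ → ℝ) {N : ℝ}
    (hB : ∀ A, ((Fintype.card V).choose A.card : ℝ) * (B A).card ≤ δ A.card * N) :
    (S.card : ℝ) ≤ (∑ a ∈ Finset.range (Fintype.card V + 1), δ a) * N := by
  have h1 : S ⊆ (Finset.univ : Finset (Finset V)).biUnion B := by
    intro G hG
    obtain ⟨A, hA⟩ := hS G hG
    exact Finset.mem_biUnion.2 ⟨A, Finset.mem_univ _, hA⟩
  have h2 : (S.card : ℝ) ≤ ∑ A : Finset V, ((B A).card : ℝ) := by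
    exact_mod_cast (Finset.card_le_card h1).trans Finset.card_biUnion_le
  refine h2.trans ?_
  have h3 : ∀ A : Finset V, ((B A).card : ℝ) ≤
      δ A.card * N / (Fintype.card V).choose A.card := fun A => by
    have : 0 < (Fintype.card V).choose A.card := Nat.choose_pos (Finset.card_le_univ A)
    rw [le_div_iff₀ (by exact_mod_cast this), mul_comm]
    exact hB A
  refine (Finset.sum_le_sum fun A _ => h3 A).trans (le_of_eq ?_)
  have h4 := Finset.sum_powerset_apply_card
    (x := (Finset.univ : Finset V)) (fun a => δ a * N / ((Fintype.card V).choose a : ℝ))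
  rw [Finset.powerset_univ] at h4
  rw [h4, Finset.sum_mul, Finset.card_univ]
  refine Finset.sum_congr rfl fun a ha => ?_
  have : 0 < (Fintype.card V).choose a := Nat.choose_pos (Finset.mem_range_succ_iff.1 ha)
  rw [nsmul_eq_mul]
  field_simp

theorem card_disconnected_le {r : ℕ} (hr : 3 ≤ r) (hn : 4 * r ^ 2 ≤ Fintype.card V) :
    (({G ∈ regGraphs V r | ¬G.Connected}).card : ℝ) ≤
      ((Fintype.card V + 1) * √((16 ^ (r ^ 2) * (12 * 24 * 256)) / (Fintype.card V : ℝ) ^ 3)) *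
        (regGraphs V r).card := by
  have hn0 : 0 < Fintype.card V := by nlinarith
  have : Nonempty V := Fintype.card_pos_iff.1 hn0
  set K : ℝ := 16 ^ (r ^ 2) * (12 * 24 * 256) with hK
  have h := card_le_of_forall_mem_cover {G ∈ regGraphs V r | ¬G.Connected}
    (fun A => if 4 ≤ A.card ∧ 2 * A.card ≤ Fintype.card V then regCross r A 0 else ∅)
    (fun G hG => by
      simp only [Finset.mem_filter, regGraphs, Finset.mem_univ, true_and] at hG
      obtain ⟨A, hA, hA2, hA0⟩ := exists_crossing_eq_zero hG.2
      refine ⟨A, ?_⟩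
      rw [if_pos ⟨four_le_card_of_crossing_eq_zero hr hG.1 hA hA0, hA2⟩]
      simp [regCross, hG.1, hA0])
    (fun _ => √(K / (Fintype.card V : ℝ) ^ 3)) (N := (regGraphs V r).card)
    (fun A => by
      split_ifs with hA
      · have h1 : (((Fintype.card V).choose A.card : ℝ) * (regCross r A 0).card) ^ 2 *
            (Fintype.card V : ℝ) ^ 3 ≤ K * ((regGraphs V r).card : ℝ) ^ 2 := by
          rw [hK]
          exact_mod_cast choose_mul_regCross_zero_le hr A hA.1 hA.2 hn
        have hn' : (0 : ℝ) < (Fintype.card V : ℝ) ^ 3 := by positivity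
        rw [← le_div_iff₀ hn'] at h1
        have h2 := Real.le_sqrt_of_sq_le h1
        refine h2.trans (le_of_eq ?_)
        rw [mul_div_right_comm, Real.sqrt_mul (by positivity), Real.sqrt_sq (by positivity)]
      · simp
        positivity)
  simpa using h

theorem card_small_cheeger_le {r : ℕ} (hr : 1 ≤ r) (hn : 8 * r ^ 2 ≤ Fintype.card V) :
    (({G ∈ regGraphs V r | cheeger G < (r : ℝ) / 2 - 16 * √r}).card : ℝ) ≤
      (8 * r / Fintype.card V) * (regGraphs V r).card := by
  have hn0 : 2 ≤ Fintype.card V := by nlinarith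
  have h := card_le_of_forall_mem_cover
    {G ∈ regGraphs V r | cheeger G < (r : ℝ) / 2 - 16 * √r}
    (fun A => if 1 ≤ A.card ∧ 2 * A.card ≤ Fintype.card V then badCross r A else ∅)
    (fun G hG => by
      simp only [Finset.mem_filter, regGraphs, Finset.mem_univ, true_and] at hG
      obtain ⟨A, hA, hA2, hA0⟩ := exists_crossing_lt hn0 hG.2
      refine ⟨A, ?_⟩
      rw [if_pos ⟨hA.card_pos, hA2⟩]
      simp only [badCross, Finset.mem_filter, Finset.mem_univ, true_and]
      exact ⟨hG.1, hA0⟩)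
    (fun a => 4 * r / Fintype.card V * (1 / 2) ^ a) (N := (regGraphs V r).card)
    (fun A => by
      split_ifs with hA
      · exact choose_mul_badCross_le hr A hA.1 hA.2 hn
      · simp
        positivity)
  refine h.trans ?_
  rw [← Finset.mul_sum]
  have h2 : ∑ i ∈ Finset.range (Fintype.card V + 1), (1 / 2 : ℝ) ^ i ≤ 2 := sum_geometric_two_le _
  gcongr
  calc _ ≤ 4 * (r : ℝ) / Fintype.card V * 2 := by gcongr
    _ = _ := by ring

end Isoperimetry

/-! ### Existence of regular graphs, so that the uniform law is not $0/0$. -/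

section Existence

open Classical

/-- The circulant graph on $\mathbb Z/n$ with connection set $T$: closure under negation gives
symmetry, and $0\notin T$ excludes loops. -/
theorem exists_isReg_of_symm {n : ℕ} (T : Finset ℕ)
    (hT : ∀ t ∈ T, 0 < t ∧ t < n ∧ n - t ∈ T) (hn : 0 < n) :
    ∃ G : SimpleGraph (Fin n), IsReg T.card G := by
  have : NeZero n := ⟨hn.ne'⟩
  have hneg : ∀ x : Fin n, x.val ∈ T → (-x).val ∈ T := by
    intro x hx
    have h1 := (hT _ hx)
    rw [Fin.val_neg', Nat.mod_eq_of_lt (by omega)]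
    exact h1.2.2
  let G : SimpleGraph (Fin n) :=
    { Adj := fun u v => (v - u).val ∈ T
      symm := ⟨fun u v h => by
        have := hneg _ h
        rwa [neg_sub] at this⟩
      loopless := ⟨fun u h => by
        rw [sub_self] at h
        exact absurd (hT _ h).1 (by simp)⟩ }
  refine ⟨G, fun u => ?_⟩
  rw [← SimpleGraph.card_neighborFinset_eq_degree]
  have hmap : ((G.neighborFinset u).map (Equiv.subRight u).toEmbedding).map Fin.valEmbedding = T := by
    ext t
    simp only [Finset.mem_map, SimpleGraph.mem_neighborFinset, Equiv.coe_toEmbedding,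
      Equiv.subRight_apply, Fin.valEmbedding_apply]
    constructor
    · rintro ⟨x, ⟨v, hv, rfl⟩, rfl⟩
      exact hv
    · intro ht
      refine ⟨⟨t, (hT t ht).2.1⟩, ⟨⟨t, (hT t ht).2.1⟩ + u, ?_, by simp⟩, rfl⟩
      change ((⟨t, (hT t ht).2.1⟩ + u - u : Fin n)).val ∈ T
      simpa using ht
  rw [← hmap, Finset.card_map, Finset.card_map]
  congr!

theorem exists_isReg {r n : ℕ} (hrn : r < n) (he : Even (n * r)) :
    ∃ G : SimpleGraph (Fin n), IsReg r G := by
  rcases Nat.even_or_odd' r with ⟨k, hk | hk⟩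
  · have h := exists_isReg_of_symm (n := n) (Finset.Icc 1 k ∪ Finset.Ico (n - k) n) (by
      intro t ht
      simp only [Finset.mem_union, Finset.mem_Icc, Finset.mem_Ico] at ht ⊢
      omega) (by omega)
    rwa [Finset.card_union_of_disjoint, Nat.card_Icc, Nat.card_Ico,
      show k + 1 - 1 + (n - (n - k)) = r by omega] at h
    rw [Finset.disjoint_left]
    intro t ht
    simp only [Finset.mem_Icc, Finset.mem_Ico] at ht ⊢
    omega
  -- For odd $r$ the self-inverse element $n/2$ supplies the unpaired neighbour.
  · obtain ⟨m, hm⟩ : Even n := by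
      rcases Nat.even_mul.1 he with h | h
      · exact h
      · rw [hk] at h
        exact absurd h (by simp)
    have h := exists_isReg_of_symm (n := n)
      ((Finset.Icc 1 k ∪ Finset.Ico (n - k) n) ∪ {m}) (by
      intro t ht
      simp only [Finset.mem_union, Finset.mem_Icc, Finset.mem_Ico, Finset.mem_singleton] at ht ⊢
      omega) (by omega)
    rwa [Finset.card_union_of_disjoint, Finset.card_union_of_disjoint, Nat.card_Icc,
      Nat.card_Ico, Finset.card_singleton,
      show k + 1 - 1 + (n - (n - k)) + 1 = r by omega] at h
    · rw [Finset.disjoint_left]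
      intro t ht
      simp only [Finset.mem_Icc, Finset.mem_Ico] at ht ⊢
      omega
    · rw [Finset.disjoint_left]
      intro t ht
      simp only [Finset.mem_union, Finset.mem_Icc, Finset.mem_Ico, Finset.mem_singleton] at ht ⊢
      omega

end Existence

/-! ### From counting to probability. -/

section HighProbability

open Classical

theorem card_filter_not_le {V : Type*} [Fintype V] {r : ℕ} (hr : 3 ≤ r)
    (hV : 8 * r ^ 2 ≤ Fintype.card V) {P : SimpleGraph V → Prop}
    (hn : ∀ G : SimpleGraph V, IsReg r G → G.Connected →
      (r : ℝ) / 2 - 16 * √r ≤ cheeger G → P G) :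
    (({G ∈ regGraphs V r | ¬P G}).card : ℝ) ≤
      (((Fintype.card V : ℝ) + 1) * √((16 ^ (r ^ 2) * (12 * 24 * 256)) / (Fintype.card V : ℝ) ^ 3) +
        8 * r / Fintype.card V) * (regGraphs V r).card := by
  have h1 := card_disconnected_le (V := V) hr (by omega)
  have h2 := card_small_cheeger_le (V := V) (r := r) (by omega) hV
  have h3 : ({G ∈ regGraphs V r | ¬P G}) ⊆ {G ∈ regGraphs V r | ¬G.Connected} ∪
      {G ∈ regGraphs V r | cheeger G < (r : ℝ) / 2 - 16 * √r} := by
    intro G hG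
    simp only [Finset.mem_union, Finset.mem_filter, regGraphs, Finset.mem_univ, true_and] at hG ⊢
    by_contra hcon
    push Not at hcon
    exact hG.2 (hn G hG.1 (hcon.1 hG.1) (hcon.2 hG.1))
  have h4 : (({G ∈ regGraphs V r | ¬P G}).card : ℝ) ≤
      ({G ∈ regGraphs V r | ¬G.Connected}).card +
      ({G ∈ regGraphs V r | cheeger G < (r : ℝ) / 2 - 16 * √r}).card := by
    exact_mod_cast (Finset.card_le_card h3).trans (Finset.card_union_le _ _)
  rw [add_mul]
  exact h4.trans (add_le_add h1 h2)

theorem natCard_isReg_and (r n : ℕ) (P : SimpleGraph (Fin n) → Prop) :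
    Nat.card {G : SimpleGraph (Fin n) // IsReg r G ∧ P G} =
      ({G ∈ regGraphs (Fin n) r | P G}).card := by
  exact Nat.subtype_card _ fun G => by simp [regGraphs]

theorem natCard_isReg (r n : ℕ) :
    Nat.card {G : SimpleGraph (Fin n) // IsReg r G} = (regGraphs (Fin n) r).card := by
  exact Nat.subtype_card _ fun G => by simp [regGraphs]

theorem regProb_le_one (r n : ℕ) (P : SimpleGraph (Fin n) → Prop) : regProb r n P ≤ 1 := by
  rw [regProb, natCard_isReg_and, natCard_isReg]
  exact div_le_one_of_le₀ (by exact_mod_cast Finset.card_filter_le _ _) (Nat.cast_nonneg _)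

theorem WHP_of_card_compl_le {r : ℕ} (P : ∀ n : ℕ, SimpleGraph (Fin n) → Prop) (δ : ℕ → ℝ)
    (hδ : Tendsto δ atTop (𝓝 0))
    (h : ∀ᶠ n in atTop, (({G ∈ regGraphs (Fin n) r | ¬P n G}).card : ℝ) ≤
      δ n * (regGraphs (Fin n) r).card) : WHP r P := by
  have hev : ∀ᶠ n in atTop ⊓ 𝓟 {n : ℕ | Even (n * r)}, 1 - δ n ≤ regProb r n (P n) := by
    rw [eventually_inf_principal]
    filter_upwards [h, eventually_gt_atTop r] with n hn hrn he
    obtain ⟨G, hG⟩ := exists_isReg hrn he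
    have hpos : 0 < (regGraphs (Fin n) r).card := Finset.card_pos.2 ⟨G, by simpa [regGraphs]⟩
    have hsum := Finset.card_filter_add_card_filter_not (s := regGraphs (Fin n) r) (P n)
    rw [regProb, natCard_isReg_and, natCard_isReg, le_div_iff₀ (by exact_mod_cast hpos)]
    have hsum' : (({G ∈ regGraphs (Fin n) r | P n G}).card : ℝ) +
      ({G ∈ regGraphs (Fin n) r | ¬P n G}).card = (regGraphs (Fin n) r).card := by
        exact_mod_cast hsum
    linarith
  have h1 : Tendsto (fun n => 1 - δ n) (atTop ⊓ 𝓟 {n : ℕ | Even (n * r)}) (𝓝 1) := by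
    have : Tendsto (fun n => 1 - δ n) atTop (𝓝 (1 - 0)) := hδ.const_sub 1
    rw [sub_zero] at this
    exact this.mono_left inf_le_left
  exact tendsto_of_tendsto_of_tendsto_of_le_of_le' h1 tendsto_const_nhds hev
    (Eventually.of_forall fun n => regProb_le_one r n _)

theorem WHP_connected_and_cheeger {r : ℕ} (hr : 3 ≤ r)
    (Q : ∀ n : ℕ, SimpleGraph (Fin n) → Prop)
    (hQ : ∀ᶠ n in atTop, ∀ G : SimpleGraph (Fin n), IsReg r G → G.Connected →
      (r : ℝ) / 2 - 16 * √r ≤ cheeger G → Q n G) : WHP r Q := by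
  set K : ℝ := 16 ^ (r ^ 2) * (12 * 24 * 256)
  refine WHP_of_card_compl_le Q
    (fun n => ((n : ℝ) + 1) * √(K / (n : ℝ) ^ 3) + 8 * r / n) ?_ ?_
  · have h1 : Tendsto (fun n : ℕ => √(((n : ℝ) + 1) ^ 2 / (n : ℝ) ^ 3 * K)) atTop (𝓝 0) := by
      have h2 : Tendsto (fun n : ℕ => 4 * K / (n : ℝ)) atTop (𝓝 0) :=
        tendsto_const_nhds.div_atTop tendsto_natCast_atTop_atTop
      have h3 : Tendsto (fun n : ℕ => ((n : ℝ) + 1) ^ 2 / (n : ℝ) ^ 3 * K) atTop (𝓝 0) := by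
        refine squeeze_zero' (Eventually.of_forall fun n => by positivity) ?_ h2
        filter_upwards [eventually_ge_atTop 1] with n hn
        have hn' : (1 : ℝ) ≤ n := by exact_mod_cast hn
        have h4 : ((n : ℝ) + 1) ^ 2 ≤ 4 * n ^ 2 := by nlinarith
        calc ((n : ℝ) + 1) ^ 2 / (n : ℝ) ^ 3 * K ≤ 4 * n ^ 2 / (n : ℝ) ^ 3 * K := by gcongr
          _ = _ := by field_simp
      simpa [Function.comp_def] using (Real.continuous_sqrt.tendsto 0).comp h3
    have h5 : Tendsto (fun n : ℕ => 8 * (r : ℝ) / (n : ℝ)) atTop (𝓝 0) :=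
        tendsto_const_nhds.div_atTop tendsto_natCast_atTop_atTop
    have h6 := h1.add h5
    rw [add_zero] at h6
    refine h6.congr fun n => ?_
    congr 1
    rw [div_mul_eq_mul_div, mul_div_assoc, Real.sqrt_mul (by positivity),
      Real.sqrt_sq (by positivity)]
  · filter_upwards [hQ, eventually_ge_atTop (8 * r ^ 2)] with n hn hn2
    have h := card_filter_not_le (V := Fin n) hr (by rwa [Fintype.card_fin]) (hn := hn)
    rwa [Fintype.card_fin] at h

end HighProbability

/-! ### The Metropolis chain: Markov property, reversibility, exit from a well. -/

section Chain

variable {V : Type*} [Fintype V] [DecidableEq V] (H : Config V → ℝ) (β : ℝ≥0)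

instance instIsProbabilityMeasureChainLaw (σ : Config V) : IsProbabilityMeasure (chainLaw H β σ) := by
  unfold chainLaw; infer_instance

theorem stepKernel_singleton (ξ ζ : Config V) :
    stepKernel H β ξ {ζ} = ENNReal.ofReal (transition H β ξ ζ) := by
  change (stepLaw H β ξ).toMeasure {ζ} = _
  rw [PMF.toMeasure_apply_singleton _ _ (measurableSet_singleton _)]
  rfl

theorem chainLaw_zero (σ : Config V) : chainLaw H β σ {ω | ω 0 ≠ σ} = 0 := by
  have hS : MeasurableSet {x : (i : Finset.Iic 0) → Config V | x ⟨0, by simp⟩ ≠ σ} :=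
    (measurableSet_eq_fun (measurable_pi_apply _) measurable_const).compl
  have h : (chainLaw H β σ).map (Preorder.frestrictLe 0)
      {x : (i : Finset.Iic 0) → Config V | x ⟨0, by simp⟩ ≠ σ} = 0 := by
    rw [chainLaw, Kernel.trajMeasure, Measure.map_comp _ _ (by fun_prop),
      Kernel.traj_map_frestrictLe, Kernel.partialTraj_self, Measure.id_comp,
      Measure.map_apply (by fun_prop) hS, Measure.dirac_apply' _ (by measurability)]
    simp only [Set.indicator_apply_eq_zero, Set.mem_preimage, Set.mem_ofPred_eq]
    intro hx
    exact absurd rfl hx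
  rwa [Measure.map_apply (by fun_prop) hS] at h

theorem chainLaw_step (σ : Config V) (t : ℕ) (B : Set ((i : Finset.Iic t) → Config V))
    (hB : MeasurableSet B) (ξ ζ : Config V) :
    (chainLaw H β σ) {ω | Preorder.frestrictLe t ω ∈ B ∧ ω t = ξ ∧ ω (t + 1) = ζ} =
      (chainLaw H β σ) {ω | Preorder.frestrictLe t ω ∈ B ∧ ω t = ξ} *
        ENNReal.ofReal (transition H β ξ ζ) := by
  set κ : (n : ℕ) → Kernel ((i : Finset.Iic n) → Config V) (Config V) := fun n =>
    (stepKernel H β).comap (fun ω : (i : Finset.Iic n) → Config V => ω ⟨n, by simp⟩)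
      (measurable_pi_apply _)
  have h := Kernel.map_frestrictLe_trajMeasure_compProd_eq_map_trajMeasure
    (X := fun _ => Config V) (μ₀ := Measure.dirac σ) (κ := κ) (a := t)
  set S : Set ((i : Finset.Iic t) → Config V) := B ∩ {x | x ⟨t, by simp⟩ = ξ}
  have hS : MeasurableSet S :=
    hB.inter (measurableSet_eq_fun (measurable_pi_apply _) measurable_const)
  have h1 := congrArg (fun m => m (S ×ˢ {ζ})) h
  beta_reduce at h1
  rw [Measure.compProd_apply_prod hS (measurableSet_singleton _),
    Measure.map_apply (by fun_prop) (hS.prod (measurableSet_singleton _))] at h1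
  have h2 : ∀ m : Measure ((i : Finset.Iic t) → Config V),
      ∫⁻ a in S, κ t a {ζ} ∂m = ENNReal.ofReal (transition H β ξ ζ) * m S := by
    intro m
    rw [← setLIntegral_const]
    refine setLIntegral_congr_fun hS fun a ha => ?_
    change stepKernel H β (a ⟨t, by simp⟩) {ζ} = _
    rw [show a ⟨t, by simp⟩ = ξ from ha.2, stepKernel_singleton]
  rw [h2, Measure.map_apply (by fun_prop) hS] at h1
  rw [mul_comm]
  have h3 : {ω : ℕ → Config V | Preorder.frestrictLe t ω ∈ B ∧ ω t = ξ ∧ ω (t + 1) = ζ} =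
      (fun x => (Preorder.frestrictLe t x, x (t + 1))) ⁻¹' (S ×ˢ {ζ}) := by
    ext ω
    simp [S, and_assoc]
  have h4 : {ω : ℕ → Config V | Preorder.frestrictLe t ω ∈ B ∧ ω t = ξ} =
      (Preorder.frestrictLe t) ⁻¹' S := by
    ext ω
    simp [S]
  rw [h3, h4]
  exact h1.symm

/-- The probability that the chain stays in `D` before time `t` and is at `ζ` at time `t`. -/
noncomputable def stayProb (σ : Config V) (D : Set (Config V)) (t : ℕ) (ζ : Config V) : ℝ :=
  (chainLaw H β σ).real {ω | (∀ s < t, ω s ∈ D) ∧ ω t = ζ}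

theorem stayProb_zero (σ : Config V) (D : Set (Config V)) (ζ : Config V) :
    stayProb H β σ D 0 ζ = if ζ = σ then 1 else 0 := by
  have h0 := chainLaw_zero H β σ
  unfold stayProb
  split_ifs with h
  · subst h
    have hm : MeasurableSet {ω : ℕ → Config V | ω 0 = ζ} :=
      measurableSet_eq_fun (measurable_pi_apply _) measurable_const
    have h1 : chainLaw H β ζ {ω | ω 0 = ζ} = 1 := (prob_compl_eq_zero_iff hm).1 h0
    simp [measureReal_def, h1]
  · rw [measureReal_def, measure_mono_null _ h0]
    · simp
    · rintro ω ⟨_, h1⟩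
      simpa [h1] using h

open Classical in
theorem stayProb_succ (σ : Config V) (D : Set (Config V)) (t : ℕ) (ζ : Config V) :
    stayProb H β σ D (t + 1) ζ =
      ∑ ξ, if ξ ∈ D then stayProb H β σ D t ξ * transition H β ξ ζ else 0 := by
  set B : Set ((i : Finset.Iic t) → Config V) :=
    {x | ∀ s : Finset.Iic t, s.1 < t → x s ∈ D} with hBdef
  have hB : MeasurableSet B := by
    have : B = ⋂ s : Finset.Iic t, {x | s.1 < t → x s ∈ D} := by ext x; simp [B]
    rw [this]
    refine MeasurableSet.iInter fun s => ?_
    by_cases hs : s.1 < t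
    · simp only [hs, forall_const]
      exact measurable_pi_apply s (Set.toFinite D).measurableSet
    · simp [hs]
  have hBmem : ∀ ω : ℕ → Config V, Preorder.frestrictLe t ω ∈ B ↔ ∀ s < t, ω s ∈ D := by
    intro ω
    constructor
    · intro h s hs
      exact h ⟨s, by simp; omega⟩ hs
    · intro h s hs
      exact h s.1 hs
  have hsplit : {ω : ℕ → Config V | (∀ s < t + 1, ω s ∈ D) ∧ ω (t + 1) = ζ} =
      ⋃ ξ ∈ (Finset.univ.filter (· ∈ D) : Finset (Config V)),
        {ω : ℕ → Config V | Preorder.frestrictLe t ω ∈ B ∧ ω t = ξ ∧ ω (t + 1) = ζ} := by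
    ext ω
    simp only [Set.mem_ofPred_eq, Set.mem_iUnion, Finset.mem_filter, Finset.mem_univ, true_and,
      hBmem, exists_prop]
    constructor
    · rintro ⟨h1, h2⟩
      exact ⟨ω t, h1 t (by omega), fun s hs => h1 s (by omega), rfl, h2⟩
    · rintro ⟨ξ, hξ, h1, rfl, h2⟩
      refine ⟨fun s hs => ?_, h2⟩
      rcases Nat.lt_succ_iff_lt_or_eq.1 hs with h | rfl
      · exact h1 s h
      · exact hξ
  have hmeas : ∀ ξ, MeasurableSet
      {ω : ℕ → Config V | Preorder.frestrictLe t ω ∈ B ∧ ω t = ξ ∧ ω (t + 1) = ζ} := by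
    intro ξ
    have m1 : MeasurableSet {ω : ℕ → Config V | Preorder.frestrictLe t ω ∈ B} :=
      (Preorder.measurable_frestrictLe t) hB
    exact m1.inter ((measurableSet_eq_fun (measurable_pi_apply _) measurable_const).inter
      (measurableSet_eq_fun (measurable_pi_apply _) measurable_const))
  rw [stayProb, hsplit, measureReal_biUnion_finset, Finset.sum_filter]
  · refine Finset.sum_congr rfl fun ξ _ => ?_
    congr 1
    rw [measureReal_def, chainLaw_step H β σ t B hB, ENNReal.toReal_mul,
      ENNReal.toReal_ofReal (transition_nonneg H β ξ ζ)]
    congr 1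
    simp only [hBmem]
    rfl
  · intro ξ _ ξ' _ hne
    rw [Function.onFun, Set.disjoint_left]
    rintro ω ⟨_, h1, _⟩ ⟨_, h2, _⟩
    exact hne (h1.symm.trans h2)
  · exact fun ξ _ => hmeas ξ

theorem transition_symm (σ η : Config V) :
    Real.exp (-(β : ℝ) * H σ) * transition H β σ η =
      Real.exp (-(β : ℝ) * H η) * transition H β η σ := by
  unfold transition
  by_cases h : σ = η
  · subst h; rfl
  · rw [if_neg h, if_neg (Ne.symm h)]
    have hc : connectivity σ η = connectivity η σ := by
      have : (∃ x, flipAt σ x = η) ↔ ∃ x, flipAt η x = σ := by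
        constructor
        · rintro ⟨x, rfl⟩; exact ⟨x, flipAt_flipAt σ x⟩
        · rintro ⟨x, rfl⟩; exact ⟨x, flipAt_flipAt η x⟩
      unfold connectivity
      simp only [this]
    rw [hc, mul_left_comm, mul_left_comm (Real.exp (-(β : ℝ) * H η)), ← Real.exp_add, ← Real.exp_add]
    congr 2
    rcases le_total (H σ) (H η) with h1 | h1
    · rw [max_eq_left (by linarith), max_eq_right (by linarith)]; ring
    · rw [max_eq_right (by linarith), max_eq_left (by linarith)]; ring

/-- The weight $e^{-\beta H}$ is stationary, and killing outside $D$ only lowers the mass, so the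
domination by the stationary weight normalised at $\sigma$ persists. -/
theorem stayProb_le (σ : Config V) (D : Set (Config V)) (t : ℕ) (ζ : Config V) :
    stayProb H β σ D t ζ ≤ Real.exp (-(β : ℝ) * (H ζ - H σ)) := by
  classical
  induction t generalizing ζ with
  | zero =>
    rw [stayProb_zero]
    split_ifs with h
    · subst h; simp
    · exact (Real.exp_pos _).le
  | succ t ih =>
    rw [stayProb_succ]
    calc _ ≤ ∑ ξ, Real.exp (-(β : ℝ) * (H ξ - H σ)) * transition H β ξ ζ := by
          refine Finset.sum_le_sum fun ξ _ => ?_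
          have h0 := transition_nonneg H β ξ ζ
          split_ifs
          · exact mul_le_mul_of_nonneg_right (ih ξ) h0
          · exact mul_nonneg (Real.exp_pos _).le h0
      _ = ∑ ξ, Real.exp (-(β : ℝ) * (H ζ - H σ)) * transition H β ζ ξ := by
          refine Finset.sum_congr rfl fun ξ _ => ?_
          have := transition_symm H β ξ ζ
          rw [mul_sub, mul_sub, sub_eq_add_neg, sub_eq_add_neg, Real.exp_add, Real.exp_add,
            mul_right_comm, this, mul_right_comm]
      _ = _ := by rw [← Finset.mul_sum, sum_transition, mul_one]

theorem stayProb_le_of_exit (σ : Config V) (D : Set (Config V)) (hσ : σ ∈ D) {Γ : ℝ}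
    (hD : ∀ ξ ∈ D, ∀ x, flipAt ξ x ∉ D → H σ + Γ ≤ H (flipAt ξ x)) (t : ℕ) (ζ : Config V)
    (hζ : ζ ∉ D) : stayProb H β σ D t ζ ≤ Real.exp (-(β : ℝ) * Γ) := by
  classical
  by_cases h : ∃ ξ ∈ D, ∃ x, flipAt ξ x = ζ
  · obtain ⟨ξ, hξ, x, rfl⟩ := h
    refine (stayProb_le H β σ D t _).trans (Real.exp_le_exp.2 ?_)
    have := hD ξ hξ x hζ
    have hβ : (0 : ℝ) ≤ β := β.2
    nlinarith
  · push Not at h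
    have : stayProb H β σ D t ζ = 0 := by
      cases t with
      | zero =>
        rw [stayProb_zero, if_neg]
        rintro rfl
        exact hζ hσ
      | succ t =>
        rw [stayProb_succ]
        refine Finset.sum_eq_zero fun ξ _ => ?_
        split_ifs with hξ
        · have h1 : ξ ≠ ζ := by rintro rfl; exact hζ hξ
          have h2 : connectivity ξ ζ = 0 := if_neg (by
            rintro ⟨x, hx⟩; exact h ξ hξ x hx)
          rw [transition, if_neg h1, h2]
          simp
        · rfl
    rw [this]
    exact (Real.exp_pos _).le

/-- The chain is unlikely to leave a well before the time needed to climb its boundary. -/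
theorem chainLaw_exists_notMem_le (σ : Config V) (D : Set (Config V)) (hσ : σ ∈ D) {Γ : ℝ}
    (hD : ∀ ξ ∈ D, ∀ x, flipAt ξ x ∉ D → H σ + Γ ≤ H (flipAt ξ x)) (T : ℕ) :
    (chainLaw H β σ).real {ω | ∃ t ≤ T, ω t ∉ D} ≤
      (T + 1) * (Fintype.card (Config V) * Real.exp (-(β : ℝ) * Γ)) := by
  classical
  have hsub : {ω : ℕ → Config V | ∃ t ≤ T, ω t ∉ D} ⊆
      ⋃ t ∈ Finset.range (T + 1), ⋃ ζ ∈ (Finset.univ.filter (· ∉ D) : Finset (Config V)),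
        {ω | (∀ s < t, ω s ∈ D) ∧ ω t = ζ} := by
    rintro ω ⟨t, ht, hω⟩
    -- Decompose by the first exit time and the exit point; each term is bounded by
    -- $e^{-\beta\Gamma}$.
    have hex : ∃ t, ω t ∉ D := ⟨t, hω⟩
    simp only [Set.mem_iUnion, Finset.mem_range, Finset.mem_filter, Finset.mem_univ, true_and,
      exists_prop]
    refine ⟨Nat.find hex, ?_, ω (Nat.find hex), Nat.find_spec hex, ?_, rfl⟩
    · have := Nat.find_min' hex hω
      omega
    · intro s hs
      have := Nat.find_min hex hs
      push Not at this
      exact this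
  calc _ ≤ (chainLaw H β σ).real (⋃ t ∈ Finset.range (T + 1),
        ⋃ ζ ∈ (Finset.univ.filter (· ∉ D) : Finset (Config V)),
        {ω | (∀ s < t, ω s ∈ D) ∧ ω t = ζ}) :=
        measureReal_mono hsub (measure_ne_top _ _)
    _ ≤ ∑ t ∈ Finset.range (T + 1), (chainLaw H β σ).real (
        ⋃ ζ ∈ (Finset.univ.filter (· ∉ D) : Finset (Config V)),
        {ω | (∀ s < t, ω s ∈ D) ∧ ω t = ζ}) := measureReal_biUnion_finset_le _ _
    _ ≤ ∑ t ∈ Finset.range (T + 1), ∑ ζ ∈ (Finset.univ.filter (· ∉ D) : Finset (Config V)),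
        stayProb H β σ D t ζ := Finset.sum_le_sum fun t _ => measureReal_biUnion_finset_le _ _
    _ ≤ ∑ t ∈ Finset.range (T + 1), ∑ ζ ∈ (Finset.univ.filter (· ∉ D) : Finset (Config V)),
        Real.exp (-(β : ℝ) * Γ) := Finset.sum_le_sum fun t _ => Finset.sum_le_sum fun ζ hζ =>
          stayProb_le_of_exit H β σ D hσ hD t ζ (Finset.mem_filter.1 hζ).2
    _ ≤ _ := by
      simp only [Finset.sum_const, nsmul_eq_mul, Finset.card_range]
      push_cast
      gcongr
      exact Finset.card_le_univ _

end Chain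

/-! ### Upper bound on the hitting time of $+1$ through the Dirichlet form. -/

section Hitting

variable {V : Type*} [Fintype V] [DecidableEq V] (H : Config V → ℝ) (β : ℝ≥0)

/-- The probability of not having visited `+1` up to time `k`, by backward recursion. -/
noncomputable def survival : ℕ → Config V → ℝ
  | 0, ξ => if ξ = plusOne V then 0 else 1
  | k + 1, ξ => if ξ = plusOne V then 0 else ∑ ζ, transition H β ξ ζ * survival k ζ

theorem survival_nonneg (k : ℕ) (ξ : Config V) : 0 ≤ survival H β k ξ := by
  induction k generalizing ξ with
  | zero => simp only [survival]; split_ifs <;> norm_num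
  | succ k ih =>
    simp only [survival]
    split_ifs
    · exact le_rfl
    · exact Finset.sum_nonneg fun ζ _ => mul_nonneg (transition_nonneg H β ξ ζ) (ih ζ)

theorem survival_plusOne (k : ℕ) : survival H β k (plusOne V) = 0 := by
  cases k <;> simp [survival]

theorem survival_succ_le (k : ℕ) (ξ : Config V) : survival H β (k + 1) ξ ≤ survival H β k ξ := by
  induction k generalizing ξ with
  | zero =>
    simp only [survival]
    split_ifs
    · exact le_rfl
    · refine (Finset.sum_le_sum fun ζ _ => ?_).trans (sum_transition H β ξ).le
      have := transition_nonneg H β ξ ζ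
      split_ifs <;> linarith
  | succ k ih =>
    rw [survival, survival]
    split_ifs
    · exact le_rfl
    · exact Finset.sum_le_sum fun ζ _ =>
        mul_le_mul_of_nonneg_left (ih ζ) (transition_nonneg H β ξ ζ)

theorem survival_antitone (ξ : Config V) : Antitone fun k => survival H β k ξ :=
  antitone_nat_of_succ_le fun k => survival_succ_le H β k ξ

/-- The Markov property at time $t$. It links the path measure to the backward recursion defining
`survival`. -/
theorem sum_stayProb_mul_survival (σ : Config V) (t k : ℕ) :
    ∑ ζ, stayProb H β σ {plusOne V}ᶜ t ζ * survival H β k ζ = survival H β (t + k) σ := by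
  induction t generalizing k with
  | zero => simp [stayProb_zero]
  | succ t ih =>
    rw [show t + 1 + k = t + (k + 1) by ring, ← ih (k + 1)]
    simp only [stayProb_succ, Finset.sum_mul]
    rw [Finset.sum_comm]
    refine Finset.sum_congr rfl fun ξ _ => ?_
    simp only [survival, Set.mem_compl_iff, Set.mem_singleton_iff]
    split_ifs with h
    · simp
    · rw [Finset.mul_sum]
      refine Finset.sum_congr rfl fun ζ _ => ?_
      ring

theorem chainLaw_forall_ne_le (σ : Config V) (T : ℕ) :
    (chainLaw H β σ).real {ω | ∀ t ≤ T, ω t ≠ plusOne V} ≤ survival H β T σ := by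
  have hsub : {ω : ℕ → Config V | ∀ t ≤ T, ω t ≠ plusOne V} ⊆
      ⋃ ζ ∈ (Finset.univ.filter (· ≠ plusOne V) : Finset (Config V)),
        {ω | (∀ s < T, ω s ∈ ({plusOne V}ᶜ : Set (Config V))) ∧ ω T = ζ} := by
    intro ω hω
    simp only [Set.mem_iUnion, Finset.mem_filter, Finset.mem_univ, true_and, exists_prop]
    exact ⟨ω T, hω T le_rfl, fun s hs => hω s hs.le, rfl⟩
  refine (measureReal_mono hsub (measure_ne_top _ _)).trans
    ((measureReal_biUnion_finset_le _ _).trans (le_of_eq ?_))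
  rw [← add_zero T, ← sum_stayProb_mul_survival, Finset.sum_filter]
  refine Finset.sum_congr rfl fun ζ _ => ?_
  simp only [survival]
  by_cases h : ζ = plusOne V
  · simp [h]
  · simp [h, stayProb]

/-- The expected time spent away from `+1` before time `T`. -/
noncomputable def occupation (T : ℕ) (ξ : Config V) : ℝ := ∑ k ∈ Finset.range T, survival H β k ξ

theorem mul_survival_le_occupation (T : ℕ) (ξ : Config V) :
    T * survival H β T ξ ≤ occupation H β T ξ := by
  rw [occupation, ← nsmul_eq_mul]
  simpa using Finset.card_nsmul_le_sum (Finset.range T) (fun k => survival H β k ξ)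
    (survival H β T ξ) fun k hk => survival_antitone H β ξ (Finset.mem_range.1 hk).le

theorem occupation_nonneg (T : ℕ) (ξ : Config V) : 0 ≤ occupation H β T ξ :=
  Finset.sum_nonneg fun k _ => survival_nonneg H β k ξ

theorem occupation_plusOne (T : ℕ) : occupation H β T (plusOne V) = 0 :=
  Finset.sum_eq_zero fun k _ => survival_plusOne H β k

/-- The sum telescopes to the difference of the survival probabilities at times $0$ and $T$.
Truncating at $T$ avoids proving first that the expected hitting time is finite. -/
theorem occupation_sub_le (T : ℕ) (ξ : Config V) (hξ : ξ ≠ plusOne V) :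
    occupation H β T ξ - ∑ ζ, transition H β ξ ζ * occupation H β T ζ ≤ 1 := by
  have h1 : ∑ ζ, transition H β ξ ζ * occupation H β T ζ =
      ∑ k ∈ Finset.range T, survival H β (k + 1) ξ := by
    simp only [occupation, Finset.mul_sum]
    rw [Finset.sum_comm]
    refine Finset.sum_congr rfl fun k _ => ?_
    simp [survival, hξ]
  rw [h1, occupation, ← Finset.sum_sub_distrib, Finset.sum_range_sub']
  have := survival_nonneg H β T ξ
  simp only [survival, if_neg hξ]
  linarith

/-- The Dirichlet form of a function is bounded below by any single edge. -/
theorem edge_le_dirichlet (f : Config V → ℝ) (ξ₀ ζ₀ : Config V) :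
    Real.exp (-(β : ℝ) * H ξ₀) * transition H β ξ₀ ζ₀ * (f ξ₀ - f ζ₀) ^ 2 ≤
      2 * ∑ ξ, Real.exp (-(β : ℝ) * H ξ) * f ξ * (f ξ - ∑ ζ, transition H β ξ ζ * f ζ) := by
  set c : Config V → Config V → ℝ := fun ξ ζ => Real.exp (-(β : ℝ) * H ξ) * transition H β ξ ζ
  have hc : ∀ ξ ζ, c ξ ζ = c ζ ξ := transition_symm H β
  have hc0 : ∀ ξ ζ, 0 ≤ c ξ ζ := fun ξ ζ =>
    mul_nonneg (Real.exp_pos _).le (transition_nonneg H β ξ ζ)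
  have h1 : ∑ ξ, Real.exp (-(β : ℝ) * H ξ) * f ξ * (f ξ - ∑ ζ, transition H β ξ ζ * f ζ) =
      ∑ ξ, ∑ ζ, c ξ ζ * (f ξ * (f ξ - f ζ)) := by
    refine Finset.sum_congr rfl fun ξ _ => ?_
    have : f ξ - ∑ ζ, transition H β ξ ζ * f ζ = ∑ ζ, transition H β ξ ζ * (f ξ - f ζ) := by
      simp only [mul_sub, Finset.sum_sub_distrib, ← Finset.sum_mul, sum_transition, one_mul]
    rw [this, Finset.mul_sum]
    refine Finset.sum_congr rfl fun ζ _ => ?_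
    simp only [c]
    ring
  have h2 : ∑ ξ, ∑ ζ, c ξ ζ * (f ξ * (f ξ - f ζ)) = ∑ ξ, ∑ ζ, c ξ ζ * (f ζ * (f ζ - f ξ)) := by
    rw [Finset.sum_comm]
    refine Finset.sum_congr rfl fun ξ _ => Finset.sum_congr rfl fun ζ _ => ?_
    rw [hc]
  have h3 : 2 * ∑ ξ, ∑ ζ, c ξ ζ * (f ξ * (f ξ - f ζ)) = ∑ ξ, ∑ ζ, c ξ ζ * (f ξ - f ζ) ^ 2 := by
    rw [two_mul]
    nth_rewrite 2 [h2]
    simp only [← Finset.sum_add_distrib]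
    refine Finset.sum_congr rfl fun ξ _ => Finset.sum_congr rfl fun ζ _ => ?_
    ring
  rw [h1, h3]
  have hterm : ∀ ξ ζ, 0 ≤ c ξ ζ * (f ξ - f ζ) ^ 2 := fun ξ ζ => mul_nonneg (hc0 ξ ζ) (sq_nonneg _)
  exact (Finset.single_le_sum (f := fun ζ => c ξ₀ ζ * (f ξ₀ - f ζ) ^ 2)
    (fun ζ _ => hterm ξ₀ ζ) (Finset.mem_univ ζ₀)).trans
    (Finset.single_le_sum (f := fun ξ => ∑ ζ, c ξ ζ * (f ξ - f ζ) ^ 2)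
      (fun ξ _ => Finset.sum_nonneg fun ζ _ => hterm ξ ζ) (Finset.mem_univ ξ₀))

/-- Flip the minus spins to plus one at a time: at most $|V|$ flips lead to $+1$. -/
theorem le_card_mul_of_flip_le (f : Config V → ℝ) (hf : f (plusOne V) = 0) {δ : ℝ}
    (hδ : ∀ ξ x, f ξ - f (flipAt ξ x) ≤ δ) (hδ0 : 0 ≤ δ) (σ : Config V) :
    f σ ≤ Fintype.card V * δ := by
  have key : ∀ (k : ℕ) (σ : Config V), ({x | σ x ≠ 1} : Finset V).card = k → f σ ≤ k * δ := by
    intro k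
    induction k with
    | zero =>
      intro σ h
      have : σ = plusOne V := by
        funext x
        by_contra hx
        have : x ∈ ({x | σ x ≠ 1} : Finset V) := by
          simpa using show ¬σ x = 1 from hx
        rw [Finset.card_eq_zero.1 h] at this
        simp at this
      rw [this, hf]; simp
    | succ k ih =>
      intro σ h
      obtain ⟨x, hx⟩ : ({x | σ x ≠ 1} : Finset V).Nonempty := Finset.card_pos.1 (by omega)
      have hx1 : σ x ≠ 1 := by simpa using hx
      have hx2 : -σ x = 1 := by
        rcases Int.units_eq_one_or (σ x) with h | h
        · exact absurd h hx1
        · rw [h]; rfl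
      have h2 : ({y | flipAt σ x y ≠ 1} : Finset V) = ({y | σ y ≠ 1} : Finset V).erase x := by
        ext y
        simp only [Finset.mem_filter, Finset.mem_univ, true_and, Finset.mem_erase]
        unfold flipAt
        by_cases hy : y = x
        · subst hy; simp [hx2]
        · simp [hy]
      have h3 := ih (flipAt σ x) (by rw [h2, Finset.card_erase_of_mem hx, h]; rfl)
      have h4 := hδ σ x
      push_cast
      linarith
  refine (key _ σ rfl).trans ?_
  gcongr
  exact Finset.card_le_univ _

/-- Let $M$ be the maximum of the occupation function $g$. Some flip lowers $g$ by at least $M/n$,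
so the Dirichlet form of $g$ is at least of order $(M/n)^2$ times a conductance. Since $(I-P)g\le1$
off $+1$, it is also at most linear in $M$. The bound is uniform in $T$. -/
theorem occupation_le [Nonempty V] {R : ℝ} (hR : ∀ ξ ζ, H ξ - H ζ ≤ R) (T : ℕ) (σ : Config V) :
    occupation H β T σ ≤
      2 * (Fintype.card V) ^ 3 * Fintype.card (Config V) * Real.exp (β * R) := by
  set g := occupation H β T with hg
  set n : ℝ := (Fintype.card V : ℝ) with hn
  have hn1 : 0 < n := by simp [hn, Fintype.card_pos]
  obtain ⟨σm, hσm⟩ := Finite.exists_max g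
  obtain ⟨σl, hσl⟩ := Finite.exists_min H
  obtain ⟨⟨ξ₀, x₀⟩, hmax⟩ := Finite.exists_max
    (fun p : Config V × V => g p.1 - g (flipAt p.1 p.2))
  set δ := g ξ₀ - g (flipAt ξ₀ x₀) with hδ
  have hδ0 : 0 ≤ δ := by
    have h1 := hmax (ξ₀, x₀)
    have h2 := hmax (flipAt ξ₀ x₀, x₀)
    simp only [flipAt_flipAt] at h1 h2
    linarith
  have hM := le_card_mul_of_flip_le g (occupation_plusOne H β T)
    (fun ξ x => hmax (ξ, x)) hδ0 σm
  set M := g σm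
  have hM0 : 0 ≤ M := occupation_nonneg H β T σm
  refine (hσm σ).trans ?_
  rcases hM0.eq_or_lt with h0 | hMpos
  · rw [← h0]; positivity
  have hd := edge_le_dirichlet H β g ξ₀ (flipAt ξ₀ x₀)
  have hup : ∑ ξ, Real.exp (-(β : ℝ) * H ξ) * g ξ * (g ξ - ∑ ζ, transition H β ξ ζ * g ζ) ≤
      Fintype.card (Config V) * (Real.exp (-(β : ℝ) * H σl) * M) := by
    rw [← nsmul_eq_mul, ← Finset.card_univ]
    refine Finset.sum_le_card_nsmul _ _ _ fun ξ _ => ?_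
    by_cases hξ : ξ = plusOne V
    · rw [hξ, hg, occupation_plusOne]
      simp only [mul_zero, zero_mul]
      positivity
    · have h1 := occupation_sub_le H β T ξ hξ
      have h2 : Real.exp (-(β : ℝ) * H ξ) ≤ Real.exp (-(β : ℝ) * H σl) := by
        rw [Real.exp_le_exp]
        have := hσl ξ
        have hβ : (0 : ℝ) ≤ β := β.2
        nlinarith
      have h3 : Real.exp (-(β : ℝ) * H ξ) * g ξ ≤ Real.exp (-(β : ℝ) * H σl) * M :=
        mul_le_mul h2 (hσm ξ) (occupation_nonneg H β T ξ) (Real.exp_pos _).le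
      calc _ ≤ Real.exp (-(β : ℝ) * H ξ) * g ξ * 1 :=
            mul_le_mul_of_nonneg_left h1
              (mul_nonneg (Real.exp_pos _).le (occupation_nonneg H β T ξ))
        _ ≤ _ := by rw [mul_one]; exact h3
  -- The conductance of an edge is $e^{-\beta\max(H(\xi),H(\zeta))}/n$, and the maximum is at most
  -- $\min H+R$.
  have hlow : Real.exp (-(β : ℝ) * (H σl + R)) * (1 / n) ≤
      Real.exp (-(β : ℝ) * H ξ₀) * transition H β ξ₀ (flipAt ξ₀ x₀) := by
    rw [transition, if_neg (flipAt_ne ξ₀ x₀).symm, connectivity, if_pos ⟨x₀, rfl⟩, mul_left_comm,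
      ← Real.exp_add, mul_comm]
    refine mul_le_mul_of_nonneg_left ?_ (by positivity)
    rw [Real.exp_le_exp]
    have hβ : (0 : ℝ) ≤ β := β.2
    have h1 : H ξ₀ + max (H (flipAt ξ₀ x₀) - H ξ₀) 0 ≤ H σl + R := by
      rcases le_total (H (flipAt ξ₀ x₀) - H ξ₀) 0 with h | h
      · rw [max_eq_right h]; linarith [hR ξ₀ σl]
      · rw [max_eq_left h]; linarith [hR (flipAt ξ₀ x₀) σl]
    nlinarith
  have hfin : Real.exp (-(β : ℝ) * (H σl + R)) * (1 / n) * (M / n) ^ 2 ≤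
      2 * (Fintype.card (Config V) * (Real.exp (-(β : ℝ) * H σl) * M)) := by
    refine le_trans ?_ (hd.trans (mul_le_mul_of_nonneg_left hup (by norm_num)))
    refine mul_le_mul hlow ?_ (by positivity)
      (mul_nonneg (Real.exp_pos _).le (transition_nonneg _ _ _ _))
    refine pow_le_pow_left₀ (by positivity) ?_ 2
    rw [div_le_iff₀ hn1, mul_comm]
    exact hM
  have hexp : Real.exp (-(β : ℝ) * (H σl + R)) * Real.exp (β * R) =
      Real.exp (-(β : ℝ) * H σl) := by
    rw [← Real.exp_add]; congr 1; ring
  rw [← hexp] at hfin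
  have hE := Real.exp_pos (-(β : ℝ) * (H σl + R))
  refine le_of_mul_le_mul_left ?_ (by positivity :
    0 < Real.exp (-(β : ℝ) * (H σl + R)) * (1 / n) * (M / n ^ 2))
  calc _ = Real.exp (-(β : ℝ) * (H σl + R)) * (1 / n) * (M / n) ^ 2 := by
        field_simp
    _ ≤ _ := hfin
    _ = _ := by field_simp

theorem chainLaw_forall_ne_le_of_range [Nonempty V] {R : ℝ} (hR : ∀ ξ ζ, H ξ - H ζ ≤ R) {T : ℕ}
    (hT : 0 < T) (σ : Config V) :
    (chainLaw H β σ).real {ω | ∀ t ≤ T, ω t ≠ plusOne V} ≤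
      2 * (Fintype.card V) ^ 3 * Fintype.card (Config V) * Real.exp (β * R) / T := by
  refine (chainLaw_forall_ne_le H β σ T).trans ?_
  rw [le_div_iff₀ (by exact_mod_cast hT), mul_comm]
  exact (mul_survival_le_occupation H β T σ).trans (occupation_le H β hR T σ)

theorem hitTime_le_iff {A : Set (Config V)} {ω : ℕ → Config V} {T : ℝ} (hT : 0 ≤ T) :
    (hitTime A ω : ℝ≥0∞) ≤ ENNReal.ofReal T ↔ ∃ t : ℕ, 0 < t ∧ (t : ℝ) ≤ T ∧ ω t ∈ A := by
  constructor
  · intro h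
    by_cases hne : Nonempty {t : ℕ // 0 < t ∧ ω t ∈ A}
    · obtain ⟨⟨t, ht, htA⟩, hteq⟩ := ENat.exists_eq_iInf
        (fun t : {t : ℕ // 0 < t ∧ ω t ∈ A} => (t.1 : ℕ∞))
      refine ⟨t, ht, ?_, htA⟩
      rw [hitTime, ← hteq] at h
      simp only [ENat.toENNReal_coe] at h
      rw [← ENNReal.ofReal_natCast] at h
      exact (ENNReal.ofReal_le_ofReal_iff hT).1 h
    · rw [not_nonempty_iff] at hne
      rw [hitTime, iInf_of_empty] at h
      simp at h
  · rintro ⟨t, ht, htT, htA⟩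
    have h1 : hitTime A ω ≤ (t : ℕ∞) := iInf_le _ (⟨t, ht, htA⟩ : {t : ℕ // 0 < t ∧ ω t ∈ A})
    have h2 : (hitTime A ω : ℝ≥0∞) ≤ ((t : ℕ∞) : ℝ≥0∞) := by exact_mod_cast h1
    refine h2.trans ?_
    rw [ENat.toENNReal_coe, ← ENNReal.ofReal_natCast]
    exact ENNReal.ofReal_le_ofReal htT

theorem one_sub_le_exitProb (σ : Config V) (a b : ℝ) :
    1 - (chainLaw H β σ).real {ω | ∃ t : ℕ, 0 < t ∧ (t : ℝ) ≤ Real.exp (β * a) ∧ ω t = plusOne V} -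
      (chainLaw H β σ).real {ω | ∀ t : ℕ, 0 < t → (t : ℝ) ≤ Real.exp (β * b) / 2 → ω t ≠ plusOne V}
      ≤ exitProb H σ a b β := by
  rw [exitProb]
  set E := {ω : ℕ → Config V |
    ENNReal.ofReal (Real.exp (β * a)) < (hitTime {plusOne V} ω : ℝ≥0∞) ∧
      (hitTime {plusOne V} ω : ℝ≥0∞) < ENNReal.ofReal (Real.exp (β * b))}
  set E1 := {ω : ℕ → Config V | ∃ t : ℕ, 0 < t ∧ (t : ℝ) ≤ Real.exp (β * a) ∧ ω t = plusOne V}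
  set E2 := {ω : ℕ → Config V |
    ∀ t : ℕ, 0 < t → (t : ℝ) ≤ Real.exp (β * b) / 2 → ω t ≠ plusOne V}
  have hcov : (Set.univ : Set (ℕ → Config V)) ⊆ E ∪ (E1 ∪ E2) := by
    intro ω _
    by_cases h1 : ω ∈ E1
    · exact Or.inr (Or.inl h1)
    by_cases h2 : ω ∈ E2
    · exact Or.inr (Or.inr h2)
    refine Or.inl ⟨?_, ?_⟩
    · rw [← not_le, hitTime_le_iff (Real.exp_pos _).le]
      exact h1
    · have h3 : ∃ t : ℕ, 0 < t ∧ (t : ℝ) ≤ Real.exp (β * b) / 2 ∧ ω t ∈ ({plusOne V} : Set _) := by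
        by_contra hcon
        push Not at hcon
        exact h2 fun t ht ht2 => hcon t ht ht2
      rw [← hitTime_le_iff (by positivity)] at h3
      refine h3.trans_lt ?_
      rw [ENNReal.ofReal_lt_ofReal_iff (Real.exp_pos _)]
      linarith [Real.exp_pos (β * b)]
  have h := measureReal_mono hcov (measure_ne_top (chainLaw H β σ) _)
  rw [probReal_univ] at h
  have h1 := measureReal_union_le (μ := chainLaw H β σ) E (E1 ∪ E2)
  have h2 := measureReal_union_le (μ := chainLaw H β σ) E1 E2
  linarith

theorem exitProb_le_one (σ : Config V) (a b : ℝ) : exitProb H σ a b β ≤ 1 := measureReal_le_one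

/-- The exit time from a well of depth `Γ` in a landscape of total height at most `R`. -/
theorem tendsto_exitProb [Nonempty V] (σ : Config V) (hσ : σ ≠ plusOne V) {Γ R : ℝ}
    (hR : ∀ ξ ζ, H ξ - H ζ ≤ R)
    (hΓ : 0 < Γ → ∃ D : Set (Config V), σ ∈ D ∧ plusOne V ∉ D ∧
      ∀ ξ ∈ D, ∀ x, flipAt ξ x ∉ D → H σ + Γ ≤ H (flipAt ξ x)) {ε : ℝ} (hε : 0 < ε) :
    Tendsto (exitProb H σ (Γ - ε) (R + ε)) atTop (𝓝 1) := by
  have hcoe : Tendsto (fun β : ℝ≥0 => (β : ℝ)) atTop atTop := NNReal.tendsto_coe_atTop.2 tendsto_id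
  have hR0 : 0 ≤ R := by simpa using hR σ σ
  set K : ℝ := 2 * (Fintype.card V) ^ 3 * Fintype.card (Config V) with hK
  have hdecay : ∀ c : ℝ, 0 < c → Tendsto (fun β : ℝ≥0 => Real.exp (-(β * c))) atTop (𝓝 0) :=
    fun c hc => Real.tendsto_exp_neg_atTop_nhds_zero.comp (hcoe.atTop_mul_const hc)
  have hlow : Tendsto (fun β : ℝ≥0 => (chainLaw H β σ).real
      {ω | ∃ t : ℕ, 0 < t ∧ (t : ℝ) ≤ Real.exp (β * (Γ - ε)) ∧ ω t = plusOne V}) atTop (𝓝 0) := by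
    -- When $\Gamma\le0$, as can happen for small $r$, and $\beta>0$, the lower time is below $1$
    -- and no positive integer time precedes it.
    by_cases hpos : 0 < Γ
    · obtain ⟨D, hσD, hp, hD⟩ := hΓ hpos
      have hlim : Tendsto (fun β : ℝ≥0 => (Fintype.card (Config V) : ℝ) *
          (Real.exp (-(β * ε)) + Real.exp (-(β * Γ)))) atTop (𝓝 0) := by
        simpa using ((hdecay ε hε).add (hdecay Γ hpos)).const_mul (Fintype.card (Config V) : ℝ)
      refine squeeze_zero (fun _ => measureReal_nonneg) (fun β => ?_) hlim
      set T := ⌊Real.exp (β * (Γ - ε))⌋₊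
      have hT : (T : ℝ) ≤ Real.exp (β * (Γ - ε)) := Nat.floor_le (Real.exp_pos _).le
      have hsub : {ω : ℕ → Config V | ∃ t : ℕ, 0 < t ∧ (t : ℝ) ≤ Real.exp (β * (Γ - ε)) ∧
          ω t = plusOne V} ⊆ {ω | ∃ t ≤ T, ω t ∉ D} := by
        rintro ω ⟨t, _, ht, hω⟩
        exact ⟨t, Nat.le_floor ht, by rwa [hω]⟩
      refine (measureReal_mono hsub (measure_ne_top _ _)).trans
        ((chainLaw_exists_notMem_le H β σ D hσD hD T).trans ?_)
      calc ((T : ℝ) + 1) * (Fintype.card (Config V) * Real.exp (-(β : ℝ) * Γ))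
          ≤ (Real.exp (β * (Γ - ε)) + 1) * (Fintype.card (Config V) * Real.exp (-(β : ℝ) * Γ)) := by
            gcongr
        _ = Fintype.card (Config V) * (Real.exp (β * (Γ - ε)) * Real.exp (-(β : ℝ) * Γ) +
            Real.exp (-(β : ℝ) * Γ)) := by ring
        _ = _ := by
            rw [← Real.exp_add]
            congr 3 <;> ring_nf
    · refine tendsto_const_nhds.congr' ?_
      filter_upwards [eventually_gt_atTop 0] with β hβ
      have hβ' : (0 : ℝ) < β := hβ
      have : {ω : ℕ → Config V | ∃ t : ℕ, 0 < t ∧ (t : ℝ) ≤ Real.exp (β * (Γ - ε)) ∧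
          ω t = plusOne V} = ∅ := by
        rw [Set.eq_empty_iff_forall_notMem]
        rintro ω ⟨t, ht, ht2, _⟩
        have h1 : Real.exp (β * (Γ - ε)) < 1 := by
          rw [Real.exp_lt_one_iff]
          nlinarith
        have h2 : (1 : ℝ) ≤ t := by exact_mod_cast ht
        linarith
      rw [this]
      simp
  have hup : Tendsto (fun β : ℝ≥0 => (chainLaw H β σ).real
      {ω | ∀ t : ℕ, 0 < t → (t : ℝ) ≤ Real.exp (β * (R + ε)) / 2 → ω t ≠ plusOne V})
      atTop (𝓝 0) := by
    have hlim : Tendsto (fun β : ℝ≥0 => 4 * K * Real.exp (-(β * ε))) atTop (𝓝 0) := by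
      simpa using (hdecay ε hε).const_mul (4 * K)
    refine squeeze_zero' (Eventually.of_forall fun _ => measureReal_nonneg) ?_ hlim
    have hbig : ∀ᶠ β : ℝ≥0 in atTop, 4 ≤ Real.exp (β * (R + ε)) :=
      (Real.tendsto_exp_atTop.comp (hcoe.atTop_mul_const (by linarith : 0 < R + ε))).eventually
        (eventually_ge_atTop 4)
    filter_upwards [hbig] with β hβ
    set E := Real.exp (β * (R + ε)) with hE
    set T := ⌊E / 2⌋₊
    have hT1 : (T : ℝ) ≤ E / 2 := Nat.floor_le (by positivity)
    have hT2 : E / 4 ≤ T := by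
      have := Nat.lt_floor_add_one (E / 2)
      linarith
    have hT3 : 0 < T := by
      have : (0 : ℝ) < T := by linarith
      exact_mod_cast this
    have hae : (chainLaw H β σ).real
        {ω | ∀ t : ℕ, 0 < t → (t : ℝ) ≤ E / 2 → ω t ≠ plusOne V} ≤
        (chainLaw H β σ).real {ω | ∀ t ≤ T, ω t ≠ plusOne V} := by
      -- The hitting time ignores time $0$ while the survival bound includes it; the two agree
      -- almost surely because $\sigma\neq+1$.
      have hsub : {ω : ℕ → Config V | ∀ t : ℕ, 0 < t → (t : ℝ) ≤ E / 2 → ω t ≠ plusOne V} ⊆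
          {ω | ∀ t ≤ T, ω t ≠ plusOne V} ∪ {ω | ω 0 ≠ σ} := by
        intro ω hω
        by_cases h0 : ω 0 = σ
        · left
          intro t ht
          rcases Nat.eq_zero_or_pos t with rfl | hpos
          · rwa [h0]
          · refine hω t hpos (le_trans ?_ hT1)
            exact_mod_cast ht
        · exact Or.inr h0
      refine (measureReal_mono hsub (measure_ne_top _ _)).trans
        ((measureReal_union_le _ _).trans (le_of_eq ?_))
      rw [measureReal_def (s := {ω : ℕ → Config V | ω 0 ≠ σ}), chainLaw_zero]
      simp
    refine hae.trans ((chainLaw_forall_ne_le_of_range H β hR hT3 σ).trans ?_)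
    rw [← hK]
    calc K * Real.exp (β * R) / T ≤ K * Real.exp (β * R) / (E / 4) := by
          gcongr
      _ = 4 * K * (Real.exp (β * R) / E) := by field_simp
      _ = _ := by
          rw [hE, ← Real.exp_sub]
          congr 2
          ring
  have hsq : Tendsto (fun β : ℝ≥0 => 1 - (chainLaw H β σ).real
      {ω | ∃ t : ℕ, 0 < t ∧ (t : ℝ) ≤ Real.exp (β * (Γ - ε)) ∧ ω t = plusOne V} -
      (chainLaw H β σ).real
      {ω | ∀ t : ℕ, 0 < t → (t : ℝ) ≤ Real.exp (β * (R + ε)) / 2 → ω t ≠ plusOne V})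
      atTop (𝓝 1) := by
    simpa using (hlow.const_sub 1).sub hup
  exact tendsto_of_tendsto_of_tendsto_of_le_of_le hsq tendsto_const_nhds
    (fun β => one_sub_le_exitProb H β σ _ _) (fun β => exitProb_le_one H β σ _ _)

end Hitting

/-! ### Energy wells and paths of single flips. -/

section Wells

variable {V : Type*} [Fintype V] [DecidableEq V]

theorem flipGraph_reachable (σ η : Config V) : (flipGraph V).Reachable σ η := by
  have key : ∀ S : Finset V, (flipGraph V).Reachable σ (fun x => if x ∈ S then η x else σ x) := by
    intro S
    induction S using Finset.induction_on with
    | empty => simp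
    | insert a S ha ih =>
      refine ih.trans ?_
      by_cases h : η a = σ a
      · have : (fun x => if x ∈ insert a S then η x else σ x) =
            fun x => if x ∈ S then η x else σ x := by
          funext x
          by_cases hx : x = a
          · subst hx; simp [ha, h]
          · simp [hx]
        rw [this]
      · refine SimpleGraph.Adj.reachable ⟨a, ?_⟩
        funext x
        unfold flipAt
        by_cases hx : x = a
        · subst hx
          rcases Int.units_eq_one_or (σ x) with h1 | h1 <;>
            rcases Int.units_eq_one_or (η x) with h2 | h2 <;> simp_all
        · simp [hx]
  simpa using key Finset.univ

theorem finite_image_support (H : Config V → ℝ) {σ η : Config V} (w : (flipGraph V).Walk σ η) :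
    (H '' {ζ | ζ ∈ w.support}).Finite := (Set.toFinite _)

theorem commHeight_le (H : Config V → ℝ) {σ η : Config V} (w : (flipGraph V).Walk σ η) :
    commHeight H σ η ≤ sSup (H '' {ζ | ζ ∈ w.support}) := by
  refine ciInf_le ⟨H σ, ?_⟩ w
  rintro _ ⟨w', rfl⟩
  exact le_csSup (finite_image_support H w').bddAbove ⟨σ, w'.start_mem_support, rfl⟩

theorem le_commHeight (H : Config V → ℝ) {σ η : Config V} {c : ℝ}
    (h : ∀ w : (flipGraph V).Walk σ η, ∃ ζ ∈ w.support, c ≤ H ζ) : c ≤ commHeight H σ η := by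
  have : Nonempty ((flipGraph V).Walk σ η) := flipGraph_reachable σ η
  refine le_ciInf fun w => ?_
  obtain ⟨ζ, hζ, hc⟩ := h w
  exact hc.trans (le_csSup (finite_image_support H w).bddAbove ⟨ζ, hζ, rfl⟩)

/-- A configuration whose stability level is at least `Γ` lies in a well of depth `Γ`. -/
theorem exists_well (H : Config V → ℝ) {σ τ : Config V} (hτ : H τ < H σ) {Γ : ℝ} (hΓ : 0 < Γ)
    (hs : (Γ : EReal) ≤ stabLevel H σ) :
    ∃ D : Set (Config V), σ ∈ D ∧ τ ∉ D ∧
      ∀ ξ ∈ D, ∀ x, flipAt ξ x ∉ D → H σ + Γ ≤ H (flipAt ξ x) := by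
  -- The well is everything reachable strictly below height $H(\sigma)+\Gamma$, so a flip leaving it
  -- must reach that height.
  refine ⟨{ξ | ∃ w : (flipGraph V).Walk σ ξ, ∀ ζ ∈ w.support, H ζ < H σ + Γ}, ?_, ?_, ?_⟩
  · refine ⟨SimpleGraph.Walk.nil, fun ζ hζ => ?_⟩
    simp only [SimpleGraph.Walk.support_nil, List.mem_singleton] at hζ
    rw [hζ]; linarith
  · rintro ⟨w, hw⟩
    have h1 : stabLevel H σ ≤ ((commHeight H σ τ - H σ : ℝ) : EReal) :=
      iInf_le _ (⟨τ, hτ⟩ : {η : Config V // H η < H σ})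
    have h2 : Γ ≤ commHeight H σ τ - H σ := EReal.coe_le_coe_iff.1 (hs.trans h1)
    have h3 : sSup (H '' {ζ | ζ ∈ w.support}) < H σ + Γ := by
      have hne : (H '' {ζ | ζ ∈ w.support}).Nonempty := ⟨H σ, σ, w.start_mem_support, rfl⟩
      obtain ⟨ζ, hζ, hζ2⟩ := hne.csSup_mem (finite_image_support H w)
      rw [← hζ2]
      exact hw ζ hζ
    have h4 := commHeight_le H w
    linarith
  · rintro ξ ⟨w, hw⟩ x hx
    by_contra hlt
    push Not at hlt
    have hadj : (flipGraph V).Adj ξ (flipAt ξ x) := ⟨x, rfl⟩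
    refine hx ⟨w.concat hadj, fun ζ hζ => ?_⟩
    rw [SimpleGraph.Walk.support_concat, List.mem_append,
      List.mem_singleton] at hζ
    rcases hζ with hζ | rfl
    · exact hw ζ hζ
    · exact hlt

/-- The vertices with spin `+1`. -/
def plusSet (σ : Config V) : Finset V := {x | σ x = 1}

theorem card_plusSet_flipAt_le (σ : Config V) (x : V) :
    (plusSet (flipAt σ x)).card ≤ (plusSet σ).card + 1 := by
  refine (Finset.card_le_card (t := insert x (plusSet σ)) ?_).trans (Finset.card_insert_le _ _)
  intro y hy
  simp only [plusSet, Finset.mem_filter, Finset.mem_univ, true_and, Finset.mem_insert] at hy ⊢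
  by_cases hyx : y = x
  · exact Or.inl hyx
  · right
    simpa [flipAt, hyx] using hy

/-- Discrete intermediate value property: a flip raises the number of plus spins by at most one. -/
theorem exists_card_plusSet_eq {σ η : Config V} (w : (flipGraph V).Walk σ η) {m : ℕ}
    (h1 : (plusSet σ).card ≤ m) (h2 : m ≤ (plusSet η).card) :
    ∃ ζ ∈ w.support, (plusSet ζ).card = m := by
  induction w with
  | @nil a => exact ⟨a, by simp, by omega⟩
  | @cons a b c hadj p ih =>
    by_cases h : (plusSet a).card = m
    · exact ⟨a, by simp, h⟩
    · have : (plusSet b).card ≤ (plusSet a).card + 1 := by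
        obtain ⟨x, rfl⟩ := hadj
        exact card_plusSet_flipAt_le a x
      obtain ⟨ζ, hζ, hc⟩ := ih (by omega) h2
      exact ⟨ζ, by simp [hζ], hc⟩

theorem plusSet_minusOne : plusSet (minusOne V) = ∅ := by
  ext x
  simp [plusSet, minusOne]

end Wells

/-! ### Energy estimates. -/

section Energy

open Classical SimpleGraph

variable {V : Type*} [Fintype V]

/-- The interaction between two vertices. -/
noncomputable def pairWeight (G : SimpleGraph V) (K : ℕ → ℝ) (x y : V) : ℝ :=
  if x ≠ y ∧ G.Reachable x y then K (G.dist x y) else 0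

theorem energy_eq (G : SimpleGraph V) (K : ℕ → ℝ) (h : ℝ) (σ : Config V) :
    energy G K h σ = -((1 / 2) * ∑ x, ∑ y, pairWeight G K x y * (spin (σ x) * spin (σ y)))
      - h * ∑ x, spin (σ x) := by
  unfold energy pairWeight
  congr 3
  refine Finset.sum_congr rfl fun x _ => Finset.sum_congr rfl fun y _ => ?_
  split_ifs <;> ring

theorem spin_eq (s : ℤˣ) : spin s = 1 ∨ spin s = -1 := by
  rcases Int.units_eq_one_or s with h | h <;> simp [spin, h]

theorem pairWeight_nonneg {K : ℕ → ℝ} (hK : ∀ i, 0 ≤ K i) (G : SimpleGraph V) (x y : V) :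
    0 ≤ pairWeight G K x y := by
  unfold pairWeight
  split_ifs
  · exact hK _
  · exact le_rfl

/-- Each unordered pair changes the energy by at most twice its weight; the double sum counts it
twice, so no factor appears. -/
theorem energy_sub_le {K : ℕ → ℝ} (hK : ∀ i, 0 ≤ K i) (G : SimpleGraph V) {h : ℝ} (hh : 0 ≤ h)
    (σ η : Config V) :
    energy G K h σ - energy G K h η ≤
      ∑ x, ∑ y, pairWeight G K x y + 2 * h * Fintype.card V := by
  have h1 : ∀ x y, pairWeight G K x y * (spin (η x) * spin (η y)) -
      pairWeight G K x y * (spin (σ x) * spin (σ y)) ≤ 2 * pairWeight G K x y := by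
    intro x y
    have := pairWeight_nonneg hK G x y
    rcases spin_eq (η x) with h1 | h1 <;> rcases spin_eq (η y) with h2 | h2 <;>
      rcases spin_eq (σ x) with h3 | h3 <;> rcases spin_eq (σ y) with h4 | h4 <;>
      rw [h1, h2, h3, h4] <;> linarith
  have h2 : ∑ x, (spin (η x) - spin (σ x)) ≤ ∑ _x : V, (2 : ℝ) :=
    Finset.sum_le_sum fun x _ => by
      rcases spin_eq (η x) with h1 | h1 <;> rcases spin_eq (σ x) with h2 | h2 <;> rw [h1, h2] <;>
        norm_num
  have h3 := Finset.sum_le_sum fun x (_ : x ∈ Finset.univ) =>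
    Finset.sum_le_sum fun y (_ : y ∈ Finset.univ) => h1 x y
  simp only [Finset.sum_sub_distrib, ← Finset.mul_sum] at h3 h2
  simp only [Finset.sum_const, Finset.card_univ, nsmul_eq_mul] at h2
  rw [energy_eq, energy_eq]
  nlinarith

theorem energy_plusOne_lt {K : ℕ → ℝ} (hK : ∀ i, 0 ≤ K i) (G : SimpleGraph V) {h : ℝ} (hh : 0 < h)
    {σ : Config V} (hσ : σ ≠ plusOne V) : energy G K h (plusOne V) < energy G K h σ := by
  have h1 : ∑ x, ∑ y, pairWeight G K x y * (spin (σ x) * spin (σ y)) ≤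
      ∑ x, ∑ y, pairWeight G K x y * (spin (plusOne V x) * spin (plusOne V y)) :=
    Finset.sum_le_sum fun x _ => Finset.sum_le_sum fun y _ => by
      refine mul_le_mul_of_nonneg_left ?_ (pairWeight_nonneg hK G x y)
      rcases spin_eq (σ x) with h1 | h1 <;> rcases spin_eq (σ y) with h2 | h2 <;>
        rw [h1, h2] <;> simp [spin, plusOne]
  have h2 : ∑ x, spin (σ x) < ∑ x, spin (plusOne V x) := by
    have hex : ∃ x, σ x ≠ 1 := by
      by_contra hcon
      push Not at hcon
      exact hσ (funext hcon)
    obtain ⟨x, hx⟩ := hex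
    refine Finset.sum_lt_sum (fun y _ => ?_) ⟨x, Finset.mem_univ _, ?_⟩
    · rcases spin_eq (σ y) with h1 | h1 <;> rw [h1] <;> simp [spin, plusOne]
    · rcases Int.units_eq_one_or (σ x) with h1 | h1
      · exact absurd h1 hx
      · simp [spin, plusOne, h1]
  rw [energy_eq, energy_eq]
  nlinarith

theorem crossing_eq_sum (G : SimpleGraph V) (A : Finset V) :
    (crossing G A : ℝ) = ∑ x, ∑ y, if x ∈ A ∧ y ∉ A ∧ G.Adj x y then 1 else 0 := by
  have : G.interedges A Aᶜ = ({p : V × V | p.1 ∈ A ∧ p.2 ∉ A ∧ G.Adj p.1 p.2} : Finset (V × V)) := by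
    ext ⟨x, y⟩
    simp [mk_mem_interedges_iff]
  rw [crossing, this, Finset.card_filter, Fintype.sum_prod_type]
  push_cast
  rfl

/-- Every pair of opposite spins raises the interaction energy above that of $-1$; only adjacent
pairs are kept. -/
theorem le_energy_sub {K : ℕ → ℝ} (hK : ∀ i, 0 ≤ K i) {J : ℝ} (hK1 : K 1 = J)
    (G : SimpleGraph V) (h : ℝ) (σ : Config V) :
    2 * J * crossing G (plusSet σ) - 2 * h * (plusSet σ).card ≤
      energy G K h σ - energy G K h (minusOne V) := by
  set A := plusSet σ
  have hmem : ∀ x, x ∈ A ↔ σ x = 1 := fun x => by simp [A, plusSet]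
  have hspin : ∀ x, spin (σ x) = if x ∈ A then 1 else -1 := by
    intro x
    rcases Int.units_eq_one_or (σ x) with h1 | h1 <;> simp [hmem, h1, spin]
  set g : V → V → ℝ := fun x y => if x ∈ A ∧ y ∉ A ∧ G.Adj x y then 1 else 0
  have h1 : ∀ x y, 2 * J * g x y + 2 * J * g y x ≤
      pairWeight G K x y * (1 - spin (σ x) * spin (σ y)) := by
    intro x y
    have h0 := pairWeight_nonneg hK G x y
    rw [hspin, hspin]
    by_cases hadj : G.Adj x y
    · have hw : pairWeight G K x y = J := by
        rw [pairWeight, if_pos ⟨hadj.ne, hadj.reachable⟩, dist_eq_one_iff_adj.2 hadj, hK1]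
      rw [hw]
      simp only [g, hadj, hadj.symm, and_true]
      by_cases hx : x ∈ A <;> by_cases hy : y ∈ A <;> simp [hx, hy] <;> linarith
    · have hadj' : ¬G.Adj y x := fun h => hadj h.symm
      simp only [g, hadj, hadj', and_false, if_false]
      by_cases hx : x ∈ A <;> by_cases hy : y ∈ A <;> simp [hx, hy] <;> linarith
  have h2 := Finset.sum_le_sum fun x (_ : x ∈ Finset.univ) =>
    Finset.sum_le_sum fun y (_ : y ∈ Finset.univ) => h1 x y
  have h3 : ∑ x, ∑ y, (2 * J * g x y + 2 * J * g y x) = 4 * J * crossing G A := by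
    simp only [Finset.sum_add_distrib, ← Finset.mul_sum]
    rw [Finset.sum_comm (f := fun x y => g y x), ← crossing_eq_sum]
    ring
  rw [h3] at h2
  simp only [mul_sub, mul_one, Finset.sum_sub_distrib] at h2
  have h4 : ∑ x, spin (σ x) = 2 * A.card - Fintype.card V := by
    have : ∀ x, spin (σ x) = 2 * (if x ∈ A then 1 else 0) - 1 := by
      intro x; rw [hspin]; split_ifs <;> norm_num
    simp only [this, Finset.sum_sub_distrib, ← Finset.mul_sum]
    simp
  have h5 : ∑ x, spin (minusOne V x) = -Fintype.card V := by simp [spin, minusOne]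
  have h6 : ∀ x y : V, spin (minusOne V x) * spin (minusOne V y) = 1 := by simp [spin, minusOne]
  rw [energy_eq, energy_eq, h4, h5]
  simp only [h6, mul_one]
  linarith

theorem cheeger_mul_card_le (G : SimpleGraph V) {A : Finset V} (hA : A.Nonempty)
    (hA2 : 2 * A.card ≤ Fintype.card V) : cheeger G * A.card ≤ crossing G A := by
  have h1 : cheeger G ≤ (crossing G A : ℝ) / A.card := by
    refine ciInf_le (ι := {A : Finset V // A.Nonempty ∧ 2 * A.card ≤ Fintype.card V})
      ⟨0, ?_⟩ ⟨A, hA, hA2⟩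
    rintro _ ⟨A', rfl⟩
    positivity
  rwa [le_div_iff₀ (by exact_mod_cast hA.card_pos)] at h1

theorem cheeger_pos {G : SimpleGraph V} (hG : G.Connected) (hV : 2 ≤ Fintype.card V) :
    0 < cheeger G := by
  obtain ⟨v⟩ := hG.nonempty
  have : Nonempty {A : Finset V // A.Nonempty ∧ 2 * A.card ≤ Fintype.card V} :=
    ⟨⟨{v}, by simp, by simpa⟩⟩
  obtain ⟨⟨A, hA, hA2⟩, hmin⟩ := exists_eq_ciInf_of_finite
    (f := fun A : {A : Finset V // A.Nonempty ∧ 2 * A.card ≤ Fintype.card V} =>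
      ((G.interedges A.1 A.1ᶜ).card : ℝ) / (A.1.card : ℝ))
  rw [cheeger, ← hmin]
  have hpos := hA.card_pos
  refine div_pos ?_ (by exact_mod_cast hpos)
  rw [Nat.cast_pos, Finset.card_pos]
  obtain ⟨u, hu⟩ := hA
  obtain ⟨w, hw⟩ : ∃ w, w ∉ A := by
    by_contra hcon
    push Not at hcon
    have : A = Finset.univ := Finset.eq_univ_iff_forall.2 hcon
    rw [this, Finset.card_univ] at hA2 hpos
    omega
  obtain ⟨p⟩ := hG.preconnected u w
  obtain ⟨d, _, hd1, hd2⟩ := p.exists_boundary_dart (A : Set V) (by simpa) (by simpa)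
  exact ⟨(d.fst, d.snd), (mk_mem_interedges_iff G).2 ⟨by simpa using hd1, by simpa using hd2, d.adj⟩⟩

end Energy

/-! ### Stability levels of $-1$ and of metastable configurations. -/

section Metastable

variable {V : Type*} [Fintype V] [DecidableEq V]

/-- The communication height between `-1` and any configuration of lower energy is at least the
energy of a configuration with half of its spins `+1`. -/
theorem le_stabLevel_minusOne {G : SimpleGraph V} {K : ℕ → ℝ} (hK : ∀ i, 0 ≤ K i) {J h Γ : ℝ}
    (hK1 : K 1 = J) (hJ : 0 ≤ J) (hV : 2 ≤ Fintype.card V) (hh : h ≤ J * cheeger G)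
    (hΓ : Γ ≤ 2 * (J * cheeger G - h) * ((Fintype.card V / 2 : ℕ) : ℝ)) :
    (Γ : EReal) ≤ stabLevel (energy G K h) (minusOne V) := by
  have hlow : ∀ ζ : Config V, (plusSet ζ).Nonempty → 2 * (plusSet ζ).card ≤ Fintype.card V →
      energy G K h (minusOne V) + 2 * (J * cheeger G - h) * (plusSet ζ).card ≤
        energy G K h ζ := by
    intro ζ h1 h2
    have h3 := cheeger_mul_card_le G h1 h2
    have h4 := le_energy_sub hK hK1 G h ζ
    have h5 := mul_le_mul_of_nonneg_left h3 hJ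
    linarith
  refine le_iInf fun η => ?_
  rw [EReal.coe_le_coe_iff, le_sub_iff_add_le']
  refine le_commHeight _ fun w => ?_
  -- With at most half of the spins plus, `hlow` and $h\le Ji_e$ give energy at least $H(-1)$.
  have hη : Fintype.card V < 2 * (plusSet η.1).card := by
    by_contra hcon
    push Not at hcon
    rcases (plusSet η.1).eq_empty_or_nonempty with he | hne
    · have : η.1 = minusOne V := by
        funext x
        have hx : x ∉ plusSet η.1 := by simp [he]
        simp only [plusSet, Finset.mem_filter, Finset.mem_univ, true_and] at hx
        exact (Int.units_eq_one_or _).resolve_left hx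
      have h2 := η.2
      rw [this] at h2
      exact lt_irrefl _ h2
    · have h1 := hlow _ hne hcon
      have h2 := η.2
      have h3 : 0 ≤ 2 * (J * cheeger G - h) * ((plusSet η.1).card : ℝ) :=
        mul_nonneg (by linarith) (Nat.cast_nonneg _)
      linarith
  obtain ⟨ζ, hζ, hc⟩ := exists_card_plusSet_eq w (m := Fintype.card V / 2)
    (by rw [plusSet_minusOne]; simp) (by omega)
  refine ⟨ζ, hζ, ?_⟩
  have h1 := hlow ζ (Finset.card_pos.1 (by omega)) (by omega)
  rw [hc] at h1
  linarith

/-- The maximal stability level dominates that of $-1$. It is finite, being attained at a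
configuration whose barrier to $+1$ is finite, whereas $+1$ has level `⊤`; so $+1$ is not
metastable. -/
theorem ne_plusOne_and_le_stabLevel [Nonempty V] {H : Config V → ℝ}
    (hmin : ∀ σ, σ ≠ plusOne V → H (plusOne V) < H σ) {Γ : EReal}
    (hΓ : Γ ≤ stabLevel H (minusOne V)) {σ : Config V}
    (hσ : σ = minusOne V ∨ σ ∈ metastableStates H) : σ ≠ plusOne V ∧ Γ ≤ stabLevel H σ := by
  have hm : minusOne V ≠ plusOne V := by
    intro h
    obtain ⟨x⟩ := ‹Nonempty V›
    have := congrFun h x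
    simp [minusOne, plusOne] at this
  have hns : ∀ τ, τ ≠ plusOne V → τ ∉ stableStates H := fun τ hτ h =>
    absurd (h (plusOne V)) (not_le.2 (hmin τ hτ))
  rcases hσ with rfl | hσ
  · exact ⟨hm, hΓ⟩
  · have hσ' : stabLevel H σ = maxStabLevel H := hσ
    have hle : stabLevel H (minusOne V) ≤ maxStabLevel H :=
      le_iSup (fun τ : {τ : Config V // τ ∉ stableStates H} => stabLevel H τ.1)
        ⟨minusOne V, hns _ hm⟩
    refine ⟨?_, hσ' ▸ hΓ.trans hle⟩
    rintro rfl
    have htop : stabLevel H (plusOne V) = ⊤ := by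
      have : IsEmpty {η : Config V // H η < H (plusOne V)} := by
        refine ⟨fun η => ?_⟩
        by_cases h : η.1 = plusOne V
        · have := η.2
          rw [h] at this
          exact lt_irrefl _ this
        · exact lt_asymm η.2 (hmin _ h)
      exact iInf_of_empty _
    have : Nonempty {τ : Config V // τ ∉ stableStates H} := ⟨⟨minusOne V, hns _ hm⟩⟩
    obtain ⟨τ, hτ⟩ := exists_eq_ciSup_of_finite
      (f := fun τ : {τ : Config V // τ ∉ stableStates H} => stabLevel H τ.1)
    have h1 : stabLevel H τ.1 = ⊤ := by
      rw [← htop, hσ', maxStabLevel]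
      exact hτ
    have hτ1 : τ.1 ≠ plusOne V := by
      intro h
      refine τ.2 fun η => ?_
      rw [h]
      by_cases hη : η = plusOne V
      · rw [hη]
      · exact (hmin _ hη).le
    have h2 : stabLevel H τ.1 ≤ ((commHeight H τ.1 (plusOne V) - H τ.1 : ℝ) : EReal) :=
      iInf_le _ (⟨plusOne V, hmin _ hτ1⟩ : {η : Config V // H η < H τ.1})
    rw [h1] at h2
    exact EReal.coe_ne_top _ (top_le_iff.1 h2)

end Metastable

/-! ### Sphere sizes, total interaction and the diameter. -/

section Spheres

open Classical SimpleGraph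

variable {V : Type*} [Fintype V]

/-- The vertices at distance `i` from `x`. -/
noncomputable def distSphere (G : SimpleGraph V) (x : V) (i : ℕ) : Finset V := {y | G.dist x y = i}

theorem exists_adj_dist_eq {G : SimpleGraph V} (hG : G.Connected) {x y : V} {i : ℕ}
    (h : G.dist x y = i + 1) : ∃ z, G.Adj y z ∧ G.dist x z = i := by
  obtain ⟨p, hp⟩ := hG.exists_walk_length_eq_dist y x
  rw [dist_comm, h] at hp
  cases p with
  | nil => simp at hp
  | @cons _ z _ hadj q =>
    refine ⟨z, hadj, ?_⟩
    rw [Walk.length_cons] at hp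
    have h1 : G.dist z x ≤ i := (dist_le q).trans (by omega)
    have h2 := hG.dist_triangle (u := x) (v := z) (w := y)
    have h3 : G.dist z y = 1 := dist_eq_one_iff_adj.2 hadj.symm
    rw [dist_comm] at h1
    omega

/-- Each vertex at positive distance from $x$ has a neighbour one step closer, leaving at most $r-1$
neighbours farther out. -/
theorem card_distSphere_succ_le {r : ℕ} {G : SimpleGraph V} (hG : G.Connected) (hr : IsReg r G)
    (x : V) (i : ℕ) : (distSphere G x (i + 1)).card ≤ r * (r - 1) ^ i := by
  induction i with
  | zero =>
    have : distSphere G x 1 = G.neighborFinset x := by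
      ext y
      simp [distSphere, dist_eq_one_iff_adj]
    rw [zero_add, this, card_neighborFinset_eq_degree, hr x]
    simp
  | succ i ih =>
    have hsub : distSphere G x (i + 1 + 1) ⊆ (distSphere G x (i + 1)).biUnion
        (fun z => (G.neighborFinset z).filter fun y => G.dist x y = i + 1 + 1) := by
      intro y hy
      simp only [distSphere, Finset.mem_filter, Finset.mem_univ, true_and] at hy
      obtain ⟨z, hz, hz2⟩ := exists_adj_dist_eq hG hy
      simp only [distSphere, Finset.mem_biUnion, Finset.mem_filter, Finset.mem_univ, true_and,
        mem_neighborFinset]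
      exact ⟨z, hz2, hz.symm, hy⟩
    refine (Finset.card_le_card hsub).trans (Finset.card_biUnion_le.trans ?_)
    calc _ ≤ ∑ _z ∈ distSphere G x (i + 1), (r - 1) := by
          refine Finset.sum_le_sum fun z hz => ?_
          simp only [distSphere, Finset.mem_filter, Finset.mem_univ, true_and] at hz
          obtain ⟨w, hw, hw2⟩ := exists_adj_dist_eq hG hz
          have h1 : ((G.neighborFinset z).filter fun y => G.dist x y = i + 1 + 1) ⊆
              (G.neighborFinset z).erase w := by
            intro y hy
            rw [Finset.mem_filter] at hy
            refine Finset.mem_erase.2 ⟨?_, hy.1⟩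
            rintro rfl
            omega
          refine (Finset.card_le_card h1).trans ?_
          rw [Finset.card_erase_of_mem (by simpa), card_neighborFinset_eq_degree, hr z]
      _ = (distSphere G x (i + 1)).card * (r - 1) := by simp
      _ ≤ r * (r - 1) ^ i * (r - 1) := Nat.mul_le_mul_right _ ih
      _ = _ := by ring

theorem sum_pairWeight_le {r : ℕ} (hr1 : 1 ≤ r) {G : SimpleGraph V} (hG : G.Connected)
    (hr : IsReg r G) {K : ℕ → ℝ} (hK : ∀ i, 0 ≤ K i) (x : V) :
    ∑ y, pairWeight G K x y ≤
      ∑ i ∈ Finset.range G.diam, r * ((r : ℝ) - 1) ^ i * K (i + 1) := by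
  have h1 : ∑ y, pairWeight G K x y = ∑ y ∈ Finset.univ.erase x, K (G.dist x y) := by
    rw [← Finset.add_sum_erase _ _ (Finset.mem_univ x)]
    simp only [pairWeight, ne_eq, not_true_eq_false, false_and, if_false, zero_add]
    refine Finset.sum_congr rfl fun y hy => ?_
    rw [if_pos ⟨(Finset.ne_of_mem_erase hy).symm, hG.preconnected x y⟩]
  have hnt : G.ediam ≠ ⊤ := by
    have : Nonempty V := hG.nonempty
    exact connected_iff_ediam_ne_top.1 hG
  have hmap : ∀ y ∈ Finset.univ.erase x, G.dist x y - 1 ∈ Finset.range G.diam := by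
    intro y hy
    have h2 : 0 < G.dist x y := hG.pos_dist_of_ne (Finset.ne_of_mem_erase hy).symm
    have h3 := dist_le_diam hnt (u := x) (v := y)
    rw [Finset.mem_range]
    omega
  rw [h1, ← Finset.sum_fiberwise_of_maps_to hmap]
  refine Finset.sum_le_sum fun i _ => ?_
  have h4 : ∀ y ∈ (Finset.univ.erase x).filter (fun y => G.dist x y - 1 = i),
      K (G.dist x y) = K (i + 1) := by
    intro y hy
    rw [Finset.mem_filter] at hy
    have h2 : 0 < G.dist x y := hG.pos_dist_of_ne (Finset.ne_of_mem_erase hy.1).symm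
    rw [show G.dist x y = i + 1 by omega]
  rw [Finset.sum_congr rfl h4, Finset.sum_const, nsmul_eq_mul]
  refine mul_le_mul_of_nonneg_right ?_ (hK _)
  have h5 : (Finset.univ.erase x).filter (fun y => G.dist x y - 1 = i) ⊆
      distSphere G x (i + 1) := by
    intro y hy
    rw [Finset.mem_filter] at hy
    have h2 : 0 < G.dist x y := hG.pos_dist_of_ne (Finset.ne_of_mem_erase hy.1).symm
    simp only [distSphere, Finset.mem_filter, Finset.mem_univ, true_and]
    omega
  have h6 := (Finset.card_le_card h5).trans (card_distSphere_succ_le hG hr x i)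
  calc _ ≤ ((r * (r - 1) ^ i : ℕ) : ℝ) := by exact_mod_cast h6
    _ = _ := by rw [Nat.cast_mul, Nat.cast_pow, Nat.cast_sub hr1, Nat.cast_one]

theorem le_diam_of_card {r : ℕ} (hr1 : 1 ≤ r) {G : SimpleGraph V} (hG : G.Connected)
    (hr : IsReg r G) {D : ℕ} (hD : D * r ^ (D + 1) + 1 < Fintype.card V) : D ≤ G.diam := by
  by_contra hlt
  push Not at hlt
  obtain ⟨x⟩ := hG.nonempty
  -- With unit weights the interaction sum counts the vertices other than $x$.
  have h1 := sum_pairWeight_le hr1 hG hr (K := fun _ => 1) (fun _ => zero_le_one) x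
  have h2 : ∑ y, pairWeight G (fun _ => 1) x y = Fintype.card V - 1 := by
    rw [← Finset.add_sum_erase _ _ (Finset.mem_univ x)]
    rw [Finset.sum_congr rfl (g := fun _ => (1 : ℝ)) fun y hy => by
      rw [pairWeight, if_pos ⟨(Finset.ne_of_mem_erase hy).symm, hG.preconnected x y⟩]]
    have : 1 ≤ Fintype.card V := by omega
    simp [pairWeight, Nat.cast_sub this]
  have hr' : (1 : ℝ) ≤ r := by exact_mod_cast hr1
  have h3 : ∑ i ∈ Finset.range G.diam, r * ((r : ℝ) - 1) ^ i * 1 ≤ D * (r : ℝ) ^ (D + 1) := by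
    calc _ ≤ ∑ _i ∈ Finset.range G.diam, (r : ℝ) ^ (D + 1) := by
          refine Finset.sum_le_sum fun i hi => ?_
          have hi' := Finset.mem_range.1 hi
          calc (r : ℝ) * ((r : ℝ) - 1) ^ i * 1 ≤ r * (r : ℝ) ^ i := by
                rw [mul_one]
                gcongr
                · linarith
            _ = (r : ℝ) ^ (i + 1) := by ring
            _ ≤ _ := pow_le_pow_right₀ hr' (by omega)
      _ = G.diam * (r : ℝ) ^ (D + 1) := by simp
      _ ≤ _ := by gcongr
  have h4 : (D : ℝ) * (r : ℝ) ^ (D + 1) + 1 < Fintype.card V := by exact_mod_cast hD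
  linarith

end Spheres

/-! ### Summing the two interactions over spheres. -/

section Interaction

theorem interaction_nonneg (r : ℕ) {J : ℝ} (hJ : 0 ≤ J) (D : Decay) (i : ℕ) :
    0 ≤ interaction r J D i := by
  cases D <;> unfold interaction <;> positivity

theorem interaction_one (r : ℕ) (J : ℝ) (D : Decay) : interaction r J D 1 = J := by
  cases D <;> simp [interaction]

/-- A geometric series of ratio $(r-1)/r$, with sum at most $r$, times the prefactor $r$. -/
theorem sum_exponential_le {r : ℕ} (hr : 1 ≤ r) (d : ℕ) :
    ∑ i ∈ Finset.range d, r * ((r : ℝ) - 1) ^ i * (r : ℝ) ^ (1 - ((i + 1 : ℕ) : ℤ)) ≤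
      (r : ℝ) * r := by
  have hr' : (1 : ℝ) ≤ r := by exact_mod_cast hr
  have hr0 : (0 : ℝ) < r := by linarith
  set q : ℝ := ((r : ℝ) - 1) / r with hq
  have hq0 : 0 ≤ q := div_nonneg (by linarith) hr0.le
  have hq1 : q < 1 := by rw [hq, div_lt_one hr0]; linarith
  have h1 : ∀ i : ℕ, r * ((r : ℝ) - 1) ^ i * (r : ℝ) ^ (1 - ((i + 1 : ℕ) : ℤ)) = r * q ^ i := by
    intro i
    rw [show (1 : ℤ) - ((i + 1 : ℕ) : ℤ) = -(i : ℤ) by push_cast; ring, zpow_neg, zpow_natCast, hq,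
      div_pow]
    field_simp
  simp only [h1, ← Finset.mul_sum]
  refine mul_le_mul_of_nonneg_left ?_ hr0.le
  have h2 := mul_neg_geom_sum q d
  have h3 : 1 - q = 1 / r := by rw [hq]; field_simp; ring
  rw [h3, one_div_mul_eq_div, div_eq_iff hr0.ne'] at h2
  rw [h2]
  have := pow_nonneg hq0 d
  nlinarith

theorem sum_polynomial_le_zeta {r : ℕ} (hr : 2 ≤ r) (d : ℕ) {lam : ℝ} (hlam : 1 < lam) :
    ∑ i ∈ Finset.range d, r * ((r : ℝ) - 1) ^ i * (((i + 1 : ℕ) : ℝ)) ^ (-lam) ≤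
      r * (zetaReal lam * ((r : ℝ) - 1) ^ d) := by
  have hr' : (2 : ℝ) ≤ r := by exact_mod_cast hr
  have hsum : Summable fun k : ℕ => ((k : ℝ) + 1) ^ (-lam) := by
    have h1 : Summable fun k : ℕ => (k : ℝ) ^ (-lam) :=
      Real.summable_nat_rpow.2 (by linarith)
    have h2 := (summable_nat_add_iff 1).2 h1
    simpa using h2
  have h3 : ∑ i ∈ Finset.range d, ((i : ℝ) + 1) ^ (-lam) ≤ zetaReal lam :=
    hsum.sum_le_tsum _ fun i _ => by positivity
  calc _ ≤ ∑ i ∈ Finset.range d, (r : ℝ) * ((r : ℝ) - 1) ^ d * ((i : ℝ) + 1) ^ (-lam) := by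
        refine Finset.sum_le_sum fun i hi => ?_
        push_cast
        refine mul_le_mul_of_nonneg_right ?_ (by positivity)
        refine mul_le_mul_of_nonneg_left ?_ (by positivity)
        exact pow_le_pow_right₀ (by linarith) (Finset.mem_range.1 hi).le
    _ = (r : ℝ) * ((r : ℝ) - 1) ^ d * ∑ i ∈ Finset.range d, ((i : ℝ) + 1) ^ (-lam) := by
        rw [Finset.mul_sum]
    _ ≤ (r : ℝ) * ((r : ℝ) - 1) ^ d * zetaReal lam := by
        refine mul_le_mul_of_nonneg_left h3 ?_
        have : (0 : ℝ) ≤ (r : ℝ) - 1 := by linarith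
        positivity
    _ = _ := by ring

theorem two_mul_pow_le_pow {r d j : ℕ} (hd : (2 * r) ^ (2 * r) ≤ d) (hj : 2 ≤ j) (hjd : j ≤ d)
    (hr : 1 ≤ r) : (2 * r) ^ j ≤ j ^ d := by
  rcases le_total (2 * r) j with h | h
  · exact (Nat.pow_le_pow_left h j).trans (Nat.pow_le_pow_right (by omega) hjd)
  · calc (2 * r) ^ j ≤ (2 * r) ^ (2 * r) := Nat.pow_le_pow_right (by omega) h
      _ ≤ d := hd
      _ ≤ 2 ^ d := Nat.lt_two_pow_self.le
      _ ≤ j ^ d := Nat.pow_le_pow_left hj d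

/-- When the diameter is huge and $\lambda\ge d$, the term at distance $j\ge2$ is at most
$r^jj^{-d}\le2^{-j}$, so nearest neighbours contribute nearly everything. -/
theorem sum_polynomial_le {r : ℕ} (hr : 1 ≤ r) {d : ℕ} (hd : (2 * r) ^ (2 * r) ≤ d) {lam : ℝ}
    (hlam : (d : ℝ) ≤ lam) :
    ∑ i ∈ Finset.range d, r * ((r : ℝ) - 1) ^ i * (((i + 1 : ℕ) : ℝ)) ^ (-lam) ≤ (r : ℝ) + 1 := by
  have hr' : (1 : ℝ) ≤ r := by exact_mod_cast hr
  have hterm : ∀ i ∈ Finset.range d, r * ((r : ℝ) - 1) ^ i * (((i + 1 : ℕ) : ℝ)) ^ (-lam) ≤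
      (if i = 0 then (r : ℝ) else 0) + 1 / 2 * (1 / 2) ^ i := by
    intro i hi
    have hid := Finset.mem_range.1 hi
    rcases Nat.eq_zero_or_pos i with rfl | hpos
    · simp
    · rw [if_neg hpos.ne', zero_add]
      have h1 : (((i + 1 : ℕ) : ℝ)) ^ (-lam) ≤ 1 / (((i + 1 : ℕ) : ℝ)) ^ d := by
        rw [one_div, ← Real.rpow_natCast, ← Real.rpow_neg (by positivity)]
        refine Real.rpow_le_rpow_of_exponent_le ?_ (by linarith)
        push_cast
        linarith [(Nat.cast_nonneg i : (0 : ℝ) ≤ i)]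
      have h2 : (2 * (r : ℝ)) ^ (i + 1) ≤ (((i + 1 : ℕ) : ℝ)) ^ d := by
        exact_mod_cast two_mul_pow_le_pow hd (by omega : 2 ≤ i + 1) hid hr
      have h3 : (r : ℝ) * ((r : ℝ) - 1) ^ i ≤ (r : ℝ) ^ (i + 1) := by
        rw [pow_succ']
        gcongr
        · linarith
      have h4 : (0 : ℝ) < (((i + 1 : ℕ) : ℝ)) ^ d := by positivity
      calc _ ≤ (r : ℝ) ^ (i + 1) * (1 / (((i + 1 : ℕ) : ℝ)) ^ d) := by gcongr
        _ ≤ (r : ℝ) ^ (i + 1) * (1 / (2 * (r : ℝ)) ^ (i + 1)) := by gcongr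
        _ = (1 / 2) ^ (i + 1) := by
            rw [mul_pow, one_div_pow]; field_simp
        _ = _ := by ring
  refine (Finset.sum_le_sum hterm).trans ?_
  rw [Finset.sum_add_distrib, ← Finset.mul_sum]
  have h5 : ∑ i ∈ Finset.range d, (1 / 2 : ℝ) ^ i ≤ 2 := sum_geometric_two_le d
  have h6 : ∑ i ∈ Finset.range d, (if i = 0 then (r : ℝ) else 0) ≤ r := by
    rw [Finset.sum_ite_eq' (Finset.range d) 0]
    split_ifs <;> linarith
  linarith

theorem sum_interaction_le {r : ℕ} (hr : 3 ≤ r) {J : ℝ} (hJ : 0 ≤ J) {D : Decay} (hD : D.Valid)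
    {d : ℕ} (hd : (2 * r) ^ (2 * r) ≤ d) :
    ∑ i ∈ Finset.range d, r * ((r : ℝ) - 1) ^ i * interaction r J D (i + 1) ≤
      J * (r * fUpper r d D + 4) := by
  have hr' : (3 : ℝ) ≤ r := by exact_mod_cast hr
  cases D with
  | exponential =>
    have h := mul_le_mul_of_nonneg_left (sum_exponential_le (by omega : 1 ≤ r) d) hJ
    rw [Finset.mul_sum] at h
    simp only [interaction, fUpper]
    calc _ = _ := Finset.sum_congr rfl fun i _ => by ring
      _ ≤ _ := h
      _ ≤ _ := by nlinarith
  | polynomial lam =>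
    have hD' : 2 < lam := hD
    simp only [interaction, fUpper]
    have heq : ∑ i ∈ Finset.range d,
        r * ((r : ℝ) - 1) ^ i * (J * (((i + 1 : ℕ) : ℝ)) ^ (-lam)) =
        J * ∑ i ∈ Finset.range d, r * ((r : ℝ) - 1) ^ i * (((i + 1 : ℕ) : ℝ)) ^ (-lam) := by
      rw [Finset.mul_sum]
      exact Finset.sum_congr rfl fun i _ => by ring
    rw [heq]
    refine mul_le_mul_of_nonneg_left ?_ hJ
    split_ifs with hlam
    -- The additive $4$ covers $r+1\le r(r-2)+4$, needed at $r=3$.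
    · refine (sum_polynomial_le (by omega) hd hlam).trans ?_
      nlinarith
    · refine (sum_polynomial_le_zeta (by omega) d (by linarith)).trans ?_
      linarith

end Interaction

/-! ### Comparison with $\Gamma_l$ and $\Gamma_u$, and the theorem. -/

section Main

theorem energy_range_le {r n : ℕ} (hr : 3 ≤ r) {G : SimpleGraph (Fin n)} (hG : G.Connected)
    (hreg : IsReg r G) (hn : (2 * r) ^ (2 * r) * r ^ ((2 * r) ^ (2 * r) + 1) + 1 < n)
    {D : Decay} (hD : D.Valid) {J h k : ℝ} (hJ : 0 ≤ J) (hh : 0 ≤ h) (hk : h ≤ k * J)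
    (σ η : Config (Fin n)) :
    energy G (interaction r J D) h σ - energy G (interaction r J D) h η ≤
      gammaUpper r n G.diam J D (2 * |k| + 4) := by
  have hK := interaction_nonneg r hJ D
  have hd := le_diam_of_card (by omega) hG hreg (by rwa [Fintype.card_fin])
  refine (energy_sub_le hK G hh σ η).trans ?_
  have h1 : ∑ x, ∑ y, pairWeight G (interaction r J D) x y ≤
      n * (J * (r * fUpper r G.diam D + 4)) := by
    refine (Finset.sum_le_sum fun x _ => (sum_pairWeight_le (by omega) hG hreg hK x).trans
      (sum_interaction_le hr hJ hD hd)).trans ?_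
    simp
  have h2 : h ≤ |k| * J := hk.trans (mul_le_mul_of_nonneg_right (le_abs_self k) hJ)
  have hn0 : (0 : ℝ) ≤ n := Nat.cast_nonneg n
  rw [gammaUpper, Fintype.card_fin]
  nlinarith

/-- The extra $1$ in the error pays for odd $n$: $(y-1)n\le y(n-1)$ as soon as $y\le n$, where
$y=r/2-16\sqrt r-|k|$. For $y\le1$ the left side is nonpositive. -/
theorem gammaLower_le {r n : ℕ} (hn : r ≤ n) {J h k c : ℝ} (hJ : 0 ≤ J) (hk : h ≤ k * J)
    (hc : (r : ℝ) / 2 - 16 * √r ≤ c) (hh : h ≤ J * c) :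
    gammaLower r n J (16 * √r + |k| + 1) ≤ 2 * (J * c - h) * ((n / 2 : ℕ) : ℝ) := by
  have h2 : h ≤ |k| * J := hk.trans (mul_le_mul_of_nonneg_right (le_abs_self k) hJ)
  have hn' : (r : ℝ) ≤ n := by exact_mod_cast hn
  have hr0 : (0 : ℝ) ≤ r := Nat.cast_nonneg r
  set y := (r : ℝ) / 2 - 16 * √r - |k| with hy
  have hyn : y ≤ n := by
    have := Real.sqrt_nonneg (r : ℝ)
    have := abs_nonneg k
    linarith
  have h3 : J * y ≤ J * c - h := by nlinarith
  have h4 : ((n : ℝ) - 1) ≤ 2 * ((n / 2 : ℕ) : ℝ) := by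
    have : n ≤ 2 * (n / 2) + 1 := by omega
    have : (n : ℝ) ≤ 2 * ((n / 2 : ℕ) : ℝ) + 1 := by exact_mod_cast this
    linarith
  have h5 : gammaLower r n J (16 * √r + |k| + 1) = J * (y - 1) * n := by
    rw [gammaLower, hy]; ring
  have hm : (0 : ℝ) ≤ ((n / 2 : ℕ) : ℝ) := Nat.cast_nonneg _
  rw [h5]
  rcases le_total y 1 with hy1 | hy1
  · have h6 : J * (y - 1) * n ≤ 0 :=
      mul_nonpos_of_nonpos_of_nonneg (mul_nonpos_of_nonneg_of_nonpos hJ (by linarith)) (by linarith)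
    have h7 : 0 ≤ 2 * (J * c - h) * ((n / 2 : ℕ) : ℝ) := mul_nonneg (by linarith) hm
    exact h6.trans h7
  · have hJy : 0 ≤ J * y := mul_nonneg hJ (by linarith)
    calc J * (y - 1) * n ≤ J * y * ((n : ℝ) - 1) := by nlinarith
      _ ≤ J * y * (2 * ((n / 2 : ℕ) : ℝ)) := mul_le_mul_of_nonneg_left h4 hJy
      _ ≤ (J * c - h) * (2 * ((n / 2 : ℕ) : ℝ)) := by gcongr
      _ = _ := by ring

theorem isLittleO_sqrt_natCast :
    (fun r : ℕ => √(r : ℝ)) =o[atTop] fun r : ℕ => (r : ℝ) := by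
  refine isLittleO_of_tendsto (fun r hr => by simp [hr]) ?_
  simp only [Real.sqrt_div_self']
  exact tendsto_const_nhds.div_atTop
    (Real.tendsto_sqrt_atTop.comp tendsto_natCast_atTop_atTop)

end Main

end RRGIsing

theorem mainTheorem3 (κ : ℕ → ℝ) (hκ : κ =o[atTop] fun r : ℕ => (r : ℝ)) :
    ∃ ol ou : ℕ → ℝ,
      (ol =o[atTop] fun r : ℕ => (r : ℝ)) ∧ (ou =o[atTop] fun r : ℕ => (r : ℝ)) ∧
      ∀ r : ℕ, 3 ≤ r →
        RRGIsing.WHP r fun n G =>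
          G.Connected ∧
          ∀ (D : RRGIsing.Decay) (J h : ℝ), RRGIsing.ParamCond r n G J h D → h ≤ κ r * J →
            ∀ σ : RRGIsing.Config (Fin n),
              (σ = RRGIsing.minusOne (Fin n) ∨
                σ ∈ RRGIsing.metastableStates
                  (RRGIsing.energy G (RRGIsing.interaction r J D) h)) →
              ∀ ε : ℝ, 0 < ε →
                Tendsto
                  (RRGIsing.exitProb (RRGIsing.energy G (RRGIsing.interaction r J D) h) σ
                    (RRGIsing.gammaLower r n J (ol r) - ε)
                    (RRGIsing.gammaUpper r n G.diam J D (ou r) + ε))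
                  atTop (𝓝 1) := by
  have habs : (fun r => |κ r|) =o[atTop] fun r : ℕ => (r : ℝ) := hκ.abs_left
  have hconst : ∀ c : ℝ, (fun _ : ℕ => c) =o[atTop] fun r : ℕ => (r : ℝ) := fun c =>
    isLittleO_const_left.2 (Or.inr (tendsto_norm_atTop_atTop.comp tendsto_natCast_atTop_atTop))
  refine ⟨fun r => 16 * √(r : ℝ) + |κ r| + 1, fun r => 2 * |κ r| + 4,
    ((RRGIsing.isLittleO_sqrt_natCast.const_mul_left 16).add habs).add (hconst 1),
    (habs.const_mul_left 2).add (hconst 4), fun r hr => ?_⟩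
  refine RRGIsing.WHP_connected_and_cheeger hr _ ?_
  -- The threshold depends on $r$ alone and forces the diameter to be at least $(2r)^{2r}$. The
  -- remaining argument is deterministic, hence simultaneous in all parameters.
  filter_upwards [eventually_gt_atTop ((2 * r) ^ (2 * r) * r ^ ((2 * r) ^ (2 * r) + 1) + 1),
    eventually_ge_atTop r] with n hn hrn G hreg hG hc
  refine ⟨hG, fun D J h hp hk σ hσ ε hε => ?_⟩
  have hJ : 0 ≤ J := zero_le_one.trans hp.one_le
  have hn2 : 2 ≤ Fintype.card (Fin n) := by rw [Fintype.card_fin]; omega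
  have : Nonempty (Fin n) := hG.nonempty
  have hcpos := RRGIsing.cheeger_pos hG hn2
  -- Connectedness makes the Cheeger constant positive, so the condition on $\lceil h/i_e\rceil$ has
  -- its intended meaning.
  have hh : h ≤ J * RRGIsing.cheeger G := by
    rw [← div_le_iff₀ hcpos]
    exact (Int.le_ceil _).trans hp.ceil_le
  have hK := RRGIsing.interaction_nonneg r hJ D
  have hΓ := RRGIsing.le_stabLevel_minusOne
    (Γ := RRGIsing.gammaLower r n J (16 * √(r : ℝ) + |κ r| + 1)) hK (RRGIsing.interaction_one r J D) hJ hn2 hh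
    (by rw [Fintype.card_fin]; exact RRGIsing.gammaLower_le hrn hJ hk hc hh)
  obtain ⟨hσ1, hσΓ⟩ := RRGIsing.ne_plusOne_and_le_stabLevel
    (fun τ hτ => RRGIsing.energy_plusOne_lt hK G hp.h_pos hτ) hΓ hσ
  exact RRGIsing.tendsto_exitProb _ σ hσ1
    (RRGIsing.energy_range_le hr hG hreg hn hp.valid hJ hp.h_pos.le hk)
    (fun hpos => RRGIsing.exists_well _ (RRGIsing.energy_plusOne_lt hK G hp.h_pos hσ1) hpos hσΓ) hε
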